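/- Let $(\theta_k)_{k\in\mathbb Z}$ be a strictly increasing real sequence with $\theta_k\to\pm\infty$ as $k\to\pm\infty$ and $\theta_{-1}<0<\theta_0$. Put $\mathbb T_0=\bigcup_{k\in\mathbb Z}[\theta_{2k-1},\theta_{2k}]$ and $\delta_k=\theta_{2k+1}-\theta_{2k}$. Suppose that $\omega>0$ satisfies $\mathbb T_0+\omega=\mathbb T_0$, and let $p$ be the number of gaps of $\mathbb T_0$ per period, i.e. $\theta_{2p}=\theta_0+\omega$ (then $\theta_{k+2p}=\theta_k+\omega$ for all $k$, so $\delta_k$ is $p$-periodic). Put $\bar\delta=\max_{0\le k\le p-1}\delta_k$; $\psi(t)=t-\sum_{0<\theta_{2k}<t}\delta_k$ for $t\ge 0$ and $\psi(t)=t+\sum_{t\le\theta_{2k}<0}\delta_k$ for $t<0$; and $s_k=\psi(\theta_{2k})$. Norms are Euclidean, with the induced norm for matrices. Let $A$ be a real $n\times n$ matrix, $f:\mathbb T_0\times\mathbb R^n\to\mathbb R^n$ rd-continuous (continuous at $(t,u)$ for right-dense $t$; for left-dense $t$ the limit of $f(r,\nu)$ as $(r,\nu)\to(t^-,u)$ exists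 and $\lim_{\nu\to u}f(t,\nu)=f(t,u)$), $\Lambda\subset\mathbb R^n$ compact and $F:\Lambda\to\Lambda$ continuous. Let $\Theta$ be the set of two-sided sequences $\zeta=(\zeta_k)_{k\in\mathbb Z}$ in $\Lambda$ with $\zeta_{k+1}=F(\zeta_k)$ for all $k\in\mathbb Z$. For $\zeta\in\Theta$ consider on $\mathbb T_0$ the dynamic equation $$y^\Delta(t)=Ay(t)+f(t,y(t))+g(t,\zeta),\qquad g(t,\zeta)=\zeta_k\ \text{ for } t\in[\theta_{2k-1},\theta_{2k}].\tag{1}$$ Here $y^\Delta$ is the $\Delta$-derivative of the continuous function $y$ on $\mathbb T_0$: $y^\Delta(\theta_{2k})=(y(\theta_{2k+1})-y(\theta_{2k}))/\delta_k$, and at the other points $y^\Delta$ is the derivative within $\mathbb T_0$. Let $\mathscr A$ be the set of all bounded solutions of (1) with $\zeta\in\Theta$. For $s\ge r$ let $X(s,r)$ be the transition matrix of the impulsive system $x'=Ax$ $(s\ne s_k)$, $x(s_k+)-x(s_k)=\delta_kAx(s_k)$, with left-continuous solutions; thus $X(s,r)=e^{(s-r)A}\prod_{r\le s_k<s}(I+\delta_kA)$.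 Assume: (C1) $\det(I+\delta_kA)\ne0$ for all $k\in\mathbb Z$; (C2) all eigenvalues of $e^{\psi(\omega)A}\prod_{j=0}^{p-1}(I+\delta_jA)$ lie inside the unit circle; (C3) $f$ is bounded on $\mathbb T_0\times\mathbb R^n$ and $F$ is bounded on $\Lambda$; (C4) $\|f(t,y_1)-f(t,y_2)\|\le L_f\|y_1-y_2\|$ for all $t\in\mathbb T_0$, $y_1,y_2\in\mathbb R^n$, where $L_f>0$; and, where $N,\lambda>0$ are numbers with $\|X(s,r)\|\le Ne^{-\lambda(s-r)}$ for all $s\ge r$, (C5) $NL_f\Big(\frac1\lambda+\frac{p\bar\delta}{1-e^{-\lambda\psi(\omega)}}\Big)<1$; (C6) $-\lambda+NL_f+\frac{p}{\psi(\omega)}\ln(1+NL_f\bar\delta)<0$; (C7) $f(t+\omega,y)=f(t,y)$ for all $(t,y)\in\mathbb T_0\times\mathbb R^n$. Suppose that $F$ is Li–Yorke chaotic on $\Lambda$: for every $m\ge1$ it has a periodic point of least period $m$, and there is an uncountable scrambled set $\mathcal S\subset\Lambda$, containing no periodic point, such that $\limsup_{k\to\infty}\|F^k(x)-F^k(y)\|>0$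 and $\liminf_{k\to\infty}\|F^k(x)-F^k(y)\|=0$ for all distinct $x,y\in\mathcal S$, and $\limsup_{k\to\infty}\|F^k(x)-F^k(z)\|>0$ for all $x\in\mathcal S$ and all periodic points $z\in\Lambda$ of $F$. Suppose also that every $x\in\mathcal S$ is the term $\zeta_0$ of some $\zeta\in\Theta$ (as is automatic if $F$ is surjective). Then equation (1) is Li–Yorke chaotic, in the following sense. (i) For every $m\ge1$ there is a solution in $\mathscr A$ that is $m\omega$-periodic but not $j\omega$-periodic for any integer $1\le j<m$. (ii) There is an uncountable set $\Sigma\subset\mathscr A$, containing no periodic function, such that any two distinct $\varphi,\tilde\varphi\in\Sigma$ are proximal (for every $\epsilon>0$ and every $E\in\mathbb N$ there is $m\in\mathbb Z$ with $\|\varphi(t)-\tilde\varphi(t)\|<\epsilon$ for all $t\in[\theta_{2m-1},\theta_{2(m+E)}]\cap\mathbb T_0$) and frequently $(\epsilon_0,\Delta)$-separated for some $\epsilon_0,\Delta>0$ (there are infinitely many disjoint intervals contained in $\mathbb T_0$, each of length at least $\Delta$, on which $\|\varphi(t)-\tilde\varphi(t)\|>\epsilon_0$). (iii) For every $\varphi\in\Sigma$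 and every periodic $\hat\varphi\in\mathscr A$, the pair $\varphi,\hat\varphi$ is frequently $(\epsilon_0,\Delta)$-separated for some $\epsilon_0,\Delta>0$. -/

import Mathlib

open Set Filter Topology

noncomputable section

/-- The forward jump operator `σ(t) = inf {s ∈ T : s > t}` of a time scale `T`. -/
def forwardJump (T : Set ℝ) (t : ℝ) : ℝ := sInf {s | s ∈ T ∧ t < s}

/-- The backward jump operator `ρ(t) = sup {s ∈ T : s < t}` of a time scale `T`. -/
def backwardJump (T : Set ℝ) (t : ℝ) : ℝ := sSup {s | s ∈ T ∧ s < t}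

/-- The continuous-at-`t` function `y : T → E` has `Δ`-derivative `d` at `t`: the difference
quotient over the jump if `t` is right-scattered, the limit of the difference quotients within `T`
if `t` is right-dense. -/
def HasDeltaDerivAt {E : Type*} [NormedAddCommGroup E] [NormedSpace ℝ E] {T : Set ℝ}
    (y : T → E) (d : E) (t : T) : Prop :=
  ContinuousAt y t ∧
  ((t : ℝ) < forwardJump T t →
    ∃ r : T, (r : ℝ) = forwardJump T t ∧ d = ((r : ℝ) - t)⁻¹ • (y r - y t)) ∧
  (forwardJump T t = t →
    Tendsto (fun r : T => ((t : ℝ) - r)⁻¹ • (y t - y r)) (𝓝[≠] t) (𝓝 d))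

/-- `rd`-continuity of `h : T × E → E`: continuity at `(t, u)` for right-dense `t`; existence of the
limit along `(r, ν) → (t-, u)` and of `lim_{ν → u} h (t, ν) = h (t, u)` for left-dense `t`. -/
def RdContinuous {E : Type*} [NormedAddCommGroup E] {T : Set ℝ} (h : T → E → E) : Prop :=
  ∀ (t : T) (u : E),
    (forwardJump T t = t → ContinuousAt (fun q : T × E => h q.1 q.2) (t, u)) ∧
    (backwardJump T t = t →
      (∃ l : E, Tendsto (fun q : T × E => h q.1 q.2) (𝓝[<] t ×ˢ 𝓝 u) (𝓝 l)) ∧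
      Tendsto (h t) (𝓝 u) (𝓝 (h t u)))

/-- The time scale `⋃ₖ [θ₂ₖ₋₁, θ₂ₖ]`. -/
def timeScale (θ : ℤ → ℝ) : Set ℝ := ⋃ k : ℤ, Icc (θ (2 * k - 1)) (θ (2 * k))

/-- The gap lengths `δₖ = θ₂ₖ₊₁ - θ₂ₖ`. -/
def gapLength (θ : ℤ → ℝ) (k : ℤ) : ℝ := θ (2 * k + 1) - θ (2 * k)

/-- The `ψ`-substitution: `t` minus the lengths of the gaps between `0` and `t` if `t ≥ 0`,
`t` plus the lengths of the gaps between `t` and `0` if `t < 0`. -/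
def psi (θ : ℤ → ℝ) (t : ℝ) : ℝ :=
  if 0 ≤ t then t - ∑ᶠ (k : ℤ) (_ : 0 < θ (2 * k) ∧ θ (2 * k) < t), gapLength θ k
  else t + ∑ᶠ (k : ℤ) (_ : t ≤ θ (2 * k) ∧ θ (2 * k) < 0), gapLength θ k

/-- The impulse moments `sₖ = ψ(θ₂ₖ)`. -/
def impulseMoment (θ : ℤ → ℝ) (k : ℤ) : ℝ := psi θ (θ (2 * k))

/-- The largest gap length `max {δₖ : 0 ≤ k ≤ p - 1}`. -/
def maxGap (θ : ℤ → ℝ) (p : ℕ) : ℝ := ⨆ k : Fin p, gapLength θ ((k : ℕ) : ℤ)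

/-- The norm of a square matrix that is induced by the Euclidean norm. -/
def matNorm {n : ℕ} (M : Matrix (Fin n) (Fin n) ℝ) : ℝ :=
  ‖Matrix.toEuclideanCLM (n := Fin n) (𝕜 := ℝ) M‖

/-- The matrix `e^{ψ(ω) A} ∏_{j=0}^{p-1} (I + δⱼ A)`. -/
def monodromyMatrix {n : ℕ} (θ : ℤ → ℝ) (A : Matrix (Fin n) (Fin n) ℝ) (ω : ℝ) (p : ℕ) :
    Matrix (Fin n) (Fin n) ℝ :=
  NormedSpace.exp (psi θ ω • A) *
    ((List.range p).map fun j => 1 + gapLength θ (j : ℤ) • A).prod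

/-- For `r ≤ s`, the transition matrix `X(s, r)` of the impulsive system `x' = A x` for `s ≠ sₖ`,
`x(sₖ+) = (I + δₖ A) x(sₖ)`, with left-continuous solutions. The impulses met on the way from `r`
to `s` are those with `r ≤ sₖ < s`. All factors are polynomials or power series in `A`, hence
commute, and the ordered product of the flows and the jumps is
`e^{(s - r) A} ∏_{r ≤ sₖ < s} (I + δₖ A)`; the product is formed among polynomials in one variable,
which is then replaced by `A`. -/
def transitionMatrix {n : ℕ} (θ : ℤ → ℝ) (A : Matrix (Fin n) (Fin n) ℝ) (s r : ℝ) :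
    Matrix (Fin n) (Fin n) ℝ :=
  NormedSpace.exp ((s - r) • A) *
    Polynomial.aeval A
      (∏ᶠ (k : ℤ) (_ : r ≤ impulseMoment θ k ∧ impulseMoment θ k < s),
        (1 + Polynomial.C (gapLength θ k) * Polynomial.X : Polynomial ℝ))

/-- The two-sided sequences `ζ` in `Λ` with `ζₖ₊₁ = F(ζₖ)` for all integers `k`. -/
def orbitSequences {α : Type*} (F : α → α) : Set (ℤ → α) := {ζ | ∀ k : ℤ, ζ (k + 1) = F (ζ k)}

/-- The map `F` is Li-Yorke chaotic, with scrambled set `S`. -/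
structure LiYorkeChaoticMap {α : Type*} [PseudoMetricSpace α] (F : α → α) (S : Set α) : Prop where
  periodic : ∀ m : ℕ, 1 ≤ m → ∃ x : α, Function.IsPeriodicPt F m x ∧ Function.minimalPeriod F x = m
  uncountable : ¬ S.Countable
  no_periodic : ∀ x ∈ S, x ∉ Function.periodicPts F
  separated : ∀ x ∈ S, ∀ y ∈ S, x ≠ y →
    0 < limsup (fun k : ℕ => dist (F^[k] x) (F^[k] y)) atTop
  proximal : ∀ x ∈ S, ∀ y ∈ S, x ≠ y →
    liminf (fun k : ℕ => dist (F^[k] x) (F^[k] y)) atTop = 0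
  separated_periodic : ∀ x ∈ S, ∀ y ∈ Function.periodicPts F,
    0 < limsup (fun k : ℕ => dist (F^[k] x) (F^[k] y)) atTop

/-- `y` solves `y^Δ(t) = A y(t) + f(t, y(t)) + g(t, ζ)` on the time scale, where `g(t, ζ) = ζₖ` for
`t ∈ [θ₂ₖ₋₁, θ₂ₖ]`. -/
def IsSolution {n : ℕ} {Λ : Set (EuclideanSpace ℝ (Fin n))} (θ : ℤ → ℝ)
    (A : Matrix (Fin n) (Fin n) ℝ)
    (f : timeScale θ → EuclideanSpace ℝ (Fin n) → EuclideanSpace ℝ (Fin n))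
    (ζ : ℤ → Λ) (y : timeScale θ → EuclideanSpace ℝ (Fin n)) : Prop :=
  ∀ (k : ℤ) (t : timeScale θ), (t : ℝ) ∈ Icc (θ (2 * k - 1)) (θ (2 * k)) →
    HasDeltaDerivAt y
      (Matrix.toEuclideanCLM (n := Fin n) (𝕜 := ℝ) A (y t) + f t (y t)
        + (ζ k : EuclideanSpace ℝ (Fin n))) t

/-- The collection of all bounded solutions that belong to sequences generated by `F`. -/
def boundedSolutions {n : ℕ} {Λ : Set (EuclideanSpace ℝ (Fin n))} (θ : ℤ → ℝ)
    (A : Matrix (Fin n) (Fin n) ℝ)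
    (f : timeScale θ → EuclideanSpace ℝ (Fin n) → EuclideanSpace ℝ (Fin n)) (F : Λ → Λ) :
    Set (timeScale θ → EuclideanSpace ℝ (Fin n)) :=
  {y | Bornology.IsBounded (range y) ∧ ∃ ζ ∈ orbitSequences F, IsSolution θ A f ζ y}

/-- The time scale `T` is invariant under the translation by `τ`. -/
def TimeScalePeriodic (T : Set ℝ) (τ : ℝ) : Prop := ∀ t : ℝ, t + τ ∈ T ↔ t ∈ T

/-- The function `y` on the time scale `T` is `τ`-periodic (`τ` need not be the least period). -/
def PeriodicWith {E : Type*} {T : Set ℝ} (y : T → E) (τ : ℝ) : Prop :=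
  TimeScalePeriodic T τ ∧ ∀ (t : T) (h : (t : ℝ) + τ ∈ T), y ⟨t + τ, h⟩ = y t

/-- Proximality of a pair of functions on the time scale. -/
def ProximalPair {E : Type*} [NormedAddCommGroup E] {θ : ℤ → ℝ} (y z : timeScale θ → E) : Prop :=
  ∀ ε : ℝ, 0 < ε → ∀ N : ℕ, ∃ m : ℤ, ∀ t : timeScale θ,
    (t : ℝ) ∈ Icc (θ (2 * m - 1)) (θ (2 * (m + N))) → ‖y t - z t‖ < ε

/-- The pair is frequently `(ε₀, Δ)`-separated for some positive `ε₀` and `Δ`: there are infinitely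
many disjoint intervals `[a q, b q]` in the time scale, of length at least `Δ`, on which the
distance exceeds `ε₀`. -/
def FrequentlySeparated {E : Type*} [NormedAddCommGroup E] {T : Set ℝ} (y z : T → E) : Prop :=
  ∃ ε₀ Δ : ℝ, 0 < ε₀ ∧ 0 < Δ ∧ ∃ a b : ℕ → ℝ,
    (∀ q, Δ ≤ b q - a q) ∧ (∀ q, Icc (a q) (b q) ⊆ T) ∧
    Pairwise (fun q q' => Disjoint (Icc (a q) (b q)) (Icc (a q') (b q'))) ∧
    ∀ q, ∀ t : T, (t : ℝ) ∈ Icc (a q) (b q) → ε₀ < ‖y t - z t‖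

/-- Li-Yorke chaos of the dynamic equation on the time scale. In `periodic`, the solution is
`mω`-periodic and `m` is the least positive integer with this property. -/
structure LiYorkeChaoticEquation {n : ℕ} {Λ : Set (EuclideanSpace ℝ (Fin n))} (θ : ℤ → ℝ) (ω : ℝ)
    (A : Matrix (Fin n) (Fin n) ℝ)
    (f : timeScale θ → EuclideanSpace ℝ (Fin n) → EuclideanSpace ℝ (Fin n)) (F : Λ → Λ) :
    Prop where
  periodic : ∀ m : ℕ, 1 ≤ m → ∃ y ∈ boundedSolutions θ A f F,
    PeriodicWith y (m * ω) ∧ ∀ j : ℕ, 1 ≤ j → j < m → ¬ PeriodicWith y (j * ω)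
  scrambled : ∃ Sig ⊆ boundedSolutions θ A f F,
    ¬ Sig.Countable ∧
    (∀ y ∈ Sig, ¬ ∃ τ : ℝ, 0 < τ ∧ PeriodicWith y τ) ∧
    (∀ y ∈ Sig, ∀ z ∈ Sig, y ≠ z → ProximalPair y z ∧ FrequentlySeparated y z) ∧
    (∀ y ∈ Sig, ∀ z ∈ boundedSolutions θ A f F, (∃ τ : ℝ, 0 < τ ∧ PeriodicWith z τ) →
      FrequentlySeparated y z)

end

/-! Every forcing sequence `ζ` in `Λ` produces exactly one bounded solution, and this correspondence
is tight enough to carry the dynamics of `F` over to the solutions.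

Existence, uniqueness and attraction rest on one contraction estimate. The supremum over the future
of `e^{lam (s - r)} ‖X(s, r) x‖` is a norm, equivalent to the Euclidean one, in which the linear
impulsive system decays at rate `lam` with constant 1 (`adaptedNorm`). In this norm a gap costs at
most the factor `1 + N * Lf * maxGap`, and the flow has a surplus of decay. By (C6) the surplus over
a period outweighs the `p` jumps, so a weight `e^{μ s - b k}`, bounded because `μ ψ(ω) = b p`, can
pay for every jump and still leave the flow contracting. The outcome is
`ImpulsiveDecay.exists_stepContraction`: passing one gap and the next interval contracts by a fixed
`κ < 1`, up to a multiple of the forcing error. Bounded solutions correspond to bounded fixed points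
of a Picard operator on functions over all intervals; an iterate of it contracts in the sup norm
(`StepContraction.exists_picard_eq`, `StepContraction.eq_of_picard_eq`).

Periodicity: uniqueness turns a periodic forcing into a periodic solution. Conversely, the jump
across the gap after interval `k` determines `ζ k` (`DeltaSolution.forcing_eq`), so a periodic
solution has a periodic forcing, and distinct points of the scrambled set give distinct solutions.
Since `ω` shifts the interval index by `p`, an `mω`-periodic solution comes from a periodic point of
`F` of least period `m * p`.

Proximality: if two orbits nearly meet once, uniform continuity keeps them close for a long stretch
of indices, and the contraction brings the solutions together there after a transient of fixed
length (`StepContraction.exists_window`).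

Separation: where the forcings differ by a vector `v` that is not small, the difference `z` of the
solutions satisfies `z' = v + O(‖z‖)` on a whole interval, so it cannot stay small there
(`exists_Icc_norm_gt`). -/

open Set Filter Topology

noncomputable section

/-! ### Geometry of the time scale, Δ-derivatives, and translations preserving the time scale. -/

section Geometry

variable {θ : ℤ → ℝ}

theorem Icc_subset_timeScale (θ : ℤ → ℝ) (k : ℤ) :
    Icc (θ (2 * k - 1)) (θ (2 * k)) ⊆ timeScale θ :=
  subset_iUnion (fun k : ℤ => Icc (θ (2 * k - 1)) (θ (2 * k))) k

theorem mem_timeScale {t : ℝ} :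
    t ∈ timeScale θ ↔ ∃ k : ℤ, t ∈ Icc (θ (2 * k - 1)) (θ (2 * k)) := mem_iUnion

theorem left_lt_right (hθ : StrictMono θ) (k : ℤ) : θ (2 * k - 1) < θ (2 * k) := hθ (by lia)

theorem left_mem_timeScale (hθ : StrictMono θ) (k : ℤ) : θ (2 * k - 1) ∈ timeScale θ :=
  Icc_subset_timeScale θ k (left_mem_Icc.2 (left_lt_right hθ k).le)

theorem right_mem_timeScale (hθ : StrictMono θ) (k : ℤ) : θ (2 * k) ∈ timeScale θ :=
  Icc_subset_timeScale θ k (right_mem_Icc.2 (left_lt_right hθ k).le)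

theorem gapLength_pos (hθ : StrictMono θ) (k : ℤ) : 0 < gapLength θ k :=
  sub_pos.2 (hθ (by lia))

theorem index_le_of_le (hθ : StrictMono θ) {k l : ℤ} {t u : ℝ}
    (ht : t ∈ Icc (θ (2 * k - 1)) (θ (2 * k))) (hu : u ∈ Icc (θ (2 * l - 1)) (θ (2 * l)))
    (htu : t ≤ u) : k ≤ l := by
  by_contra! h
  have : θ (2 * l) < θ (2 * k - 1) := hθ (by lia)
  linarith [ht.1, hu.2]

theorem index_unique (hθ : StrictMono θ) {k l : ℤ} {t : ℝ}
    (ht : t ∈ Icc (θ (2 * k - 1)) (θ (2 * k))) (hu : t ∈ Icc (θ (2 * l - 1)) (θ (2 * l))) :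
    k = l :=
  le_antisymm (index_le_of_le hθ ht hu le_rfl) (index_le_of_le hθ hu ht le_rfl)

theorem mem_Icc_of_mem_Ioo (hθ : StrictMono θ) {k : ℤ} {t : ℝ} (ht : t ∈ timeScale θ)
    (h : t ∈ Ioo (θ (2 * k - 2)) (θ (2 * k + 1))) : t ∈ Icc (θ (2 * k - 1)) (θ (2 * k)) := by
  obtain ⟨l, hl⟩ := mem_timeScale.1 ht
  have h1 : 2 * k - 2 < 2 * l := hθ.lt_iff_lt.1 (h.1.trans_le hl.2)
  have h2 : 2 * l - 1 < 2 * k + 1 := hθ.lt_iff_lt.1 (hl.1.trans_lt h.2)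
  obtain rfl : l = k := by lia
  exact hl

theorem nhdsWithin_timeScale (hθ : StrictMono θ) {k : ℤ} {t : ℝ}
    (ht : t ∈ Icc (θ (2 * k - 1)) (θ (2 * k))) :
    𝓝[timeScale θ] t = 𝓝[Icc (θ (2 * k - 1)) (θ (2 * k))] t := by
  have hU : Ioo (θ (2 * k - 2)) (θ (2 * k + 1)) ∈ 𝓝 t :=
    Ioo_mem_nhds ((hθ (by lia)).trans_le ht.1) (ht.2.trans_lt (hθ (by lia)))
  refine nhdsWithin_eq_nhdsWithin' hU ?_
  ext u
  exact ⟨fun h => ⟨mem_Icc_of_mem_Ioo hθ h.1 h.2, h.2⟩,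
    fun h => ⟨Icc_subset_timeScale θ k h.1, h.2⟩⟩

theorem forwardJump_right (hθ : StrictMono θ) (k : ℤ) :
    forwardJump (timeScale θ) (θ (2 * k)) = θ (2 * k + 1) := by
  have h : 2 * (k + 1) - 1 = 2 * k + 1 := by ring
  have hm : θ (2 * k + 1) ∈ {s | s ∈ timeScale θ ∧ θ (2 * k) < s} :=
    ⟨h ▸ left_mem_timeScale hθ (k + 1), hθ (by lia)⟩
  refine IsLeast.csInf_eq ⟨hm, fun s hs => ?_⟩
  obtain ⟨l, hl⟩ := mem_timeScale.1 hs.1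
  have h1 : 2 * k < 2 * l := hθ.lt_iff_lt.1 (hs.2.trans_le hl.2)
  exact (hθ.monotone (by lia)).trans hl.1

theorem forwardJump_of_lt {k : ℤ} {t : ℝ}
    (ht : t ∈ Ico (θ (2 * k - 1)) (θ (2 * k))) : forwardJump (timeScale θ) t = t := by
  refine csInf_eq_of_forall_ge_of_forall_gt_exists_lt ?_ (fun s hs => hs.2.le) fun w hw => ?_
  · exact ⟨θ (2 * k), Icc_subset_timeScale θ k (right_mem_Icc.2 (ht.1.trans ht.2.le)), ht.2⟩
  · obtain ⟨s, hs, hs'⟩ := exists_between (lt_min hw ht.2)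
    exact ⟨s, ⟨Icc_subset_timeScale θ k ⟨ht.1.trans hs.le, (hs'.trans_le (min_le_right _ _)).le⟩,
      hs⟩, hs'.trans_le (min_le_left _ _)⟩

/-- The point of the `k`-th interval of the time scale that is nearest to `t`. -/
def clampPt (hθ : StrictMono θ) (k : ℤ) (t : ℝ) : timeScale θ :=
  inclusion (Icc_subset_timeScale θ k) (projIcc _ _ (left_lt_right hθ k).le t)

theorem continuous_clampPt (hθ : StrictMono θ) (k : ℤ) : Continuous (clampPt hθ k) :=
  (continuous_inclusion _).comp continuous_projIcc

theorem clampPt_mem (hθ : StrictMono θ) (k : ℤ) (t : ℝ) :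
    (clampPt hθ k t : ℝ) ∈ Icc (θ (2 * k - 1)) (θ (2 * k)) :=
  (projIcc _ _ (left_lt_right hθ k).le t).2

theorem clampPt_of_mem (hθ : StrictMono θ) {k : ℤ} {t : ℝ}
    (ht : t ∈ Icc (θ (2 * k - 1)) (θ (2 * k))) :
    clampPt hθ k t = ⟨t, Icc_subset_timeScale θ k ht⟩ := by
  simp [clampPt, projIcc_of_mem _ ht]

theorem coe_clampPt_of_mem (hθ : StrictMono θ) {k : ℤ} {t : ℝ}
    (ht : t ∈ Icc (θ (2 * k - 1)) (θ (2 * k))) : (clampPt hθ k t : ℝ) = t := by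
  rw [clampPt_of_mem hθ ht]

theorem clampPt_clampPt (hθ : StrictMono θ) (k : ℤ) (t : ℝ) :
    clampPt hθ k (clampPt hθ k t : ℝ) = clampPt hθ k t :=
  Subtype.ext (coe_clampPt_of_mem hθ (clampPt_mem hθ k t))

theorem clampPt_coe (hθ : StrictMono θ) {k : ℤ} {t : timeScale θ}
    (ht : (t : ℝ) ∈ Icc (θ (2 * k - 1)) (θ (2 * k))) : clampPt hθ k t = t :=
  Subtype.ext (coe_clampPt_of_mem hθ ht)

variable {E : Type*} [NormedAddCommGroup E] [NormedSpace ℝ E]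

theorem eventually_mem_Icc (hθ : StrictMono θ) {k : ℤ} {t : timeScale θ}
    (ht : (t : ℝ) ∈ Icc (θ (2 * k - 1)) (θ (2 * k))) :
    ∀ᶠ r : timeScale θ in 𝓝 t, (r : ℝ) ∈ Icc (θ (2 * k - 1)) (θ (2 * k)) := by
  have hU : Ioo (θ (2 * k - 2)) (θ (2 * k + 1)) ∈ 𝓝 (t : ℝ) :=
    Ioo_mem_nhds ((hθ (by lia)).trans_le ht.1) (ht.2.trans_lt (hθ (by lia)))
  filter_upwards [continuous_subtype_val.continuousAt.preimage_mem_nhds hU] with r hr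
  exact mem_Icc_of_mem_Ioo hθ r.2 hr

theorem tendsto_nhdsNE_timeScale_iff (hθ : StrictMono θ) {β : Type*} {k : ℤ}
    {t : timeScale θ} (ht : (t : ℝ) ∈ Icc (θ (2 * k - 1)) (θ (2 * k))) (g : ℝ → β) (l : Filter β) :
    Tendsto (fun r : timeScale θ => g r) (𝓝[≠] t) l ↔
      Tendsto g (𝓝[Icc (θ (2 * k - 1)) (θ (2 * k)) \ {(t : ℝ)}] (t : ℝ)) l := by
  have h1 : map ((↑) : timeScale θ → ℝ) (𝓝[≠] t)
      = 𝓝[(timeScale θ : Set ℝ) \ {(t : ℝ)}] (t : ℝ) := by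
    rw [Topology.IsEmbedding.subtypeVal.map_nhdsWithin_eq]
    congr 1
    ext u
    simp only [mem_image, mem_compl_iff, mem_singleton_iff, Set.mem_sdiff]
    constructor
    · rintro ⟨v, hv, rfl⟩
      exact ⟨v.2, fun h => hv (Subtype.ext h)⟩
    · rintro ⟨hu, hne⟩
      exact ⟨⟨u, hu⟩, fun h => hne (congrArg Subtype.val h), rfl⟩
  have h2 : 𝓝[(timeScale θ : Set ℝ) \ {(t : ℝ)}] (t : ℝ)
      = 𝓝[Icc (θ (2 * k - 1)) (θ (2 * k)) \ {(t : ℝ)}] (t : ℝ) := by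
    rw [Set.sdiff_eq, Set.sdiff_eq, nhdsWithin_inter', nhdsWithin_inter',
      nhdsWithin_timeScale hθ ht]
  rw [← h2, ← h1, tendsto_map'_iff]
  rfl

/-- Near a point of the `k`-th interval the time scale is that interval alone, so the limit defining
the Δ-derivative is a derivative within a compact interval. Precomposing with `clampPt` makes `y` a
function on the whole line, to which ordinary calculus applies. -/
theorem tendsto_slope_timeScale_iff (hθ : StrictMono θ) {k : ℤ} {t : timeScale θ}
    (ht : (t : ℝ) ∈ Icc (θ (2 * k - 1)) (θ (2 * k))) (y : timeScale θ → E) (d : E) :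
    Tendsto (fun r : timeScale θ => ((t : ℝ) - r)⁻¹ • (y t - y r)) (𝓝[≠] t) (𝓝 d) ↔
      HasDerivWithinAt (fun u => y (clampPt hθ k u)) d (Icc (θ (2 * k - 1)) (θ (2 * k))) t := by
  rw [hasDerivWithinAt_iff_tendsto_slope, ← tendsto_nhdsNE_timeScale_iff hθ ht]
  refine tendsto_congr' ?_
  filter_upwards [(eventually_mem_Icc hθ ht).filter_mono nhdsWithin_le_nhds] with r hr
  rw [slope_def_module, clampPt_coe hθ ht, clampPt_coe hθ hr, ← neg_sub (r : ℝ), ← neg_sub (y r),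
    inv_neg, neg_smul_neg]

theorem HasDeltaDerivAt.hasDerivWithinAt (hθ : StrictMono θ) {y : timeScale θ → E} {d : E} {k : ℤ}
    {t : timeScale θ} (ht : (t : ℝ) ∈ Ico (θ (2 * k - 1)) (θ (2 * k)))
    (h : HasDeltaDerivAt y d t) :
    HasDerivWithinAt (fun u => y (clampPt hθ k u)) d (Icc (θ (2 * k - 1)) (θ (2 * k))) t :=
  (tendsto_slope_timeScale_iff hθ (Ico_subset_Icc_self ht) y d).1 (h.2.2 (forwardJump_of_lt ht))

theorem HasDeltaDerivAt.eq_of_right (hθ : StrictMono θ) {y : timeScale θ → E} {d : E} {k : ℤ}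
    (h : HasDeltaDerivAt y d (clampPt hθ k (θ (2 * k)))) :
    y (clampPt hθ (k + 1) (θ (2 * k + 1)))
      = y (clampPt hθ k (θ (2 * k))) + gapLength θ k • d := by
  have hk : (clampPt hθ k (θ (2 * k)) : ℝ) = θ (2 * k) :=
    coe_clampPt_of_mem hθ (right_mem_Icc.2 (left_lt_right hθ k).le)
  have hk' : (clampPt hθ (k + 1) (θ (2 * k + 1)) : ℝ) = θ (2 * k + 1) := by
    have := left_mem_Icc.2 (left_lt_right hθ (k + 1)).le
    rw [show 2 * (k + 1) - 1 = 2 * k + 1 by ring] at this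
    exact coe_clampPt_of_mem hθ (by rwa [show 2 * (k + 1) - 1 = 2 * k + 1 by ring])
  obtain ⟨r, hr, hd⟩ := h.2.1 (by rw [hk, forwardJump_right hθ]; exact hθ (by lia))
  rw [hk, forwardJump_right hθ] at hr
  obtain rfl : r = clampPt hθ (k + 1) (θ (2 * k + 1)) := Subtype.ext (hr.trans hk'.symm)
  rw [hd, hk, hk', show θ (2 * k + 1) - θ (2 * k) = gapLength θ k from rfl,
    smul_inv_smul₀ (gapLength_pos hθ k).ne', add_sub_cancel]

theorem hasDeltaDerivAt_of_lt (hθ : StrictMono θ) {y : timeScale θ → E} {d : E} {k : ℤ}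
    {t : timeScale θ} (ht : (t : ℝ) ∈ Ico (θ (2 * k - 1)) (θ (2 * k))) (hy : ContinuousAt y t)
    (h : HasDerivWithinAt (fun u => y (clampPt hθ k u)) d (Icc (θ (2 * k - 1)) (θ (2 * k))) t) :
    HasDeltaDerivAt y d t :=
  ⟨hy, fun h' => absurd (forwardJump_of_lt ht) h'.ne',
    fun _ => (tendsto_slope_timeScale_iff hθ (Ico_subset_Icc_self ht) y d).2 h⟩

theorem hasDeltaDerivAt_of_right (hθ : StrictMono θ) {y : timeScale θ → E} {d : E} {k : ℤ}
    (hy : ContinuousAt y (clampPt hθ k (θ (2 * k))))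
    (h : y (clampPt hθ (k + 1) (θ (2 * k + 1)))
      = y (clampPt hθ k (θ (2 * k))) + gapLength θ k • d) :
    HasDeltaDerivAt y d (clampPt hθ k (θ (2 * k))) := by
  have hk : (clampPt hθ k (θ (2 * k)) : ℝ) = θ (2 * k) :=
    coe_clampPt_of_mem hθ (right_mem_Icc.2 (left_lt_right hθ k).le)
  have hk' : (clampPt hθ (k + 1) (θ (2 * k + 1)) : ℝ) = θ (2 * k + 1) := by
    have := left_mem_Icc.2 (left_lt_right hθ (k + 1)).le
    rw [show 2 * (k + 1) - 1 = 2 * k + 1 by ring] at this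
    exact coe_clampPt_of_mem hθ (by rwa [show 2 * (k + 1) - 1 = 2 * k + 1 by ring])
  refine ⟨hy, fun _ => ⟨clampPt hθ (k + 1) (θ (2 * k + 1)), ?_, ?_⟩, fun h' => ?_⟩
  · rw [hk, hk', forwardJump_right hθ]
  · rw [hk, hk', h, add_sub_cancel_left, show θ (2 * k + 1) - θ (2 * k) = gapLength θ k from rfl,
      inv_smul_smul₀ (gapLength_pos hθ k).ne']
  · rw [hk, forwardJump_right hθ] at h'
    exact absurd h' (hθ (by lia)).ne'

theorem TimeScalePeriodic.forwardJump {T : Set ℝ} {τ : ℝ} (h : TimeScalePeriodic T τ) {t : ℝ}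
    (hne : {s | s ∈ T ∧ t < s}.Nonempty) :
    forwardJump T (t + τ) = forwardJump T t + τ := by
  have hS : {s | s ∈ T ∧ t + τ < s} = (OrderIso.addRight τ) '' {s | s ∈ T ∧ t < s} := by
    ext s
    simp only [mem_ofPred_eq, mem_image, OrderIso.addRight_apply]
    constructor
    · rintro ⟨hs, hlt⟩
      exact ⟨s - τ, ⟨(h _).1 (by simpa using hs), by linarith⟩, by ring⟩
    · rintro ⟨u, ⟨hu, hlt⟩, rfl⟩
      exact ⟨(h u).2 hu, by linarith⟩
  unfold _root_.forwardJump
  rw [hS]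
  exact ((OrderIso.addRight τ).map_csInf' hne ⟨t, fun s hs => hs.2.le⟩).symm

theorem nonempty_gt_right (hθ : StrictMono θ) (k : ℤ) :
    {s | s ∈ timeScale θ ∧ θ (2 * k) < s}.Nonempty :=
  ⟨θ (2 * (k + 1)), right_mem_timeScale hθ _, hθ (by lia)⟩

theorem lt_forwardJump_iff (hθ : StrictMono θ) {t : ℝ} (ht : t ∈ timeScale θ) :
    t < forwardJump (timeScale θ) t ↔ ∃ k : ℤ, t = θ (2 * k) := by
  constructor
  · intro h
    obtain ⟨k, hk⟩ := mem_timeScale.1 ht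
    refine ⟨k, hk.2.eq_of_not_lt fun hlt => ?_⟩
    exact h.ne' (forwardJump_of_lt ⟨hk.1, hlt⟩)
  · rintro ⟨k, rfl⟩
    rw [forwardJump_right hθ]
    exact hθ (by lia)

/-- An order automorphism of the integers preserves successors. This rigidity forces a translation
of the time scale to act on interval indices as a shift. -/
theorem int_eq_id_of_strictMono_of_surjective {σ : ℤ → ℤ} (h : StrictMono σ)
    (hs : Function.Surjective σ) (h0 : σ 0 = 0) (k : ℤ) : σ k = k := by
  have hstep : ∀ k, σ (k + 1) = σ k + 1 := fun k => by
    obtain ⟨j, hj⟩ := hs (σ k + 1)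
    have h1 : k < j := h.lt_iff_lt.1 (by lia)
    have h2 : σ (k + 1) ≤ σ j := h.monotone (by lia)
    have h3 : σ k < σ (k + 1) := h (by lia)
    lia
  induction k using Int.induction_on with
  | zero => exact h0
  | succ i ih => rw [hstep, ih]
  | pred i ih =>
    have := hstep (-(i : ℤ) - 1)
    rw [sub_add_cancel, ih] at this
    lia

/-- The right ends are exactly the right-scattered points, a property that any translation
preserving the time scale respects. -/
theorem exists_right_add_of_periodic (hθ : StrictMono θ) {τ : ℝ}
    (h : TimeScalePeriodic (timeScale θ) τ) (k : ℤ) : ∃ l : ℤ, θ (2 * l) = θ (2 * k) + τ := by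
  have := (lt_forwardJump_iff hθ ((h _).2 (right_mem_timeScale hθ k))).1
    (by
      rw [h.forwardJump (nonempty_gt_right hθ k), forwardJump_right hθ]
      linarith [hθ (show 2 * k < 2 * k + 1 by lia)])
  exact this.imp fun l hl => hl.symm

theorem TimeScalePeriodic.neg {T : Set ℝ} {τ : ℝ} (h : TimeScalePeriodic T τ) :
    TimeScalePeriodic T (-τ) := fun t => by
  rw [← h (t + -τ), neg_add_cancel_right]

theorem TimeScalePeriodic.add {T : Set ℝ} {τ υ : ℝ} (h : TimeScalePeriodic T τ)
    (h' : TimeScalePeriodic T υ) : TimeScalePeriodic T (τ + υ) := fun t => by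
  rw [← add_assoc, h', h]

theorem TimeScalePeriodic.natMul {T : Set ℝ} {τ : ℝ} (h : TimeScalePeriodic T τ) (j : ℕ) :
    TimeScalePeriodic T (j * τ) := by
  induction j with
  | zero => intro t; simp
  | succ j ih => rw [Nat.cast_succ, add_one_mul]; exact ih.add h

theorem shift_of_periodic (hθ : StrictMono θ) {τ : ℝ} (h : TimeScalePeriodic (timeScale θ) τ)
    {q : ℤ} (hq : θ (2 * q) = θ 0 + τ) (k : ℤ) : θ (k + 2 * q) = θ k + τ := by
  have heven : ∀ k : ℤ, θ (2 * k + 2 * q) = θ (2 * k) + τ := by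
    choose σ hσ using exists_right_add_of_periodic hθ h
    choose σ' hσ' using exists_right_add_of_periodic hθ h.neg
    -- The index map `σ` of the translation is increasing, and onto because translation by `-τ` also
    -- preserves the time scale. Subtracting `q` normalises its value at 0.
    have hid := int_eq_id_of_strictMono_of_surjective (σ := fun k => σ k - q) ?_ ?_ ?_
    · intro k
      rw [← hσ k]
      congr 1
      have := hid k
      lia
    · intro i j hij
      have : σ i < σ j := by
        have : 2 * σ i < 2 * σ j := hθ.lt_iff_lt.1 (by
          rw [hσ, hσ]; linarith [hθ (show 2 * i < 2 * j by lia)])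
        lia
      exact sub_lt_sub_right this q
    · intro j
      refine ⟨σ' (j + q), ?_⟩
      have : 2 * σ (σ' (j + q)) = 2 * (j + q) := hθ.injective (by rw [hσ, hσ']; ring)
      change σ (σ' (j + q)) - q = j
      lia
    · have : 2 * σ 0 = 2 * q := hθ.injective (by rw [hσ, hq]; rfl)
      change σ 0 - q = 0
      lia
  obtain ⟨j, rfl | rfl⟩ := Int.even_or_odd' k
  · exact heven j
  -- Odd indices follow from even ones, since `θ (2 * j + 1)` is the forward jump of `θ (2 * j)`.
  · rw [← forwardJump_right hθ, ← h.forwardJump (nonempty_gt_right hθ j), ← heven, ← mul_add,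
      forwardJump_right hθ]
    congr 1
    ring

theorem exists_shift_of_periodic (hθ : StrictMono θ) {τ : ℝ} (hτ : 0 < τ)
    (h : TimeScalePeriodic (timeScale θ) τ) : ∃ q : ℕ, 0 < q ∧ θ (2 * (q : ℤ)) = θ 0 + τ := by
  obtain ⟨l, hl⟩ := exists_right_add_of_periodic hθ h 0
  rw [mul_zero] at hl
  have : 0 < 2 * l := hθ.lt_iff_lt.1 (by rw [hl]; linarith)
  lift l to ℕ using by lia
  exact ⟨l, by lia, hl⟩

end Geometry

/-! ### The ψ-substitution and the transition operators. -/

section Clock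

variable {θ : ℤ → ℝ}

theorem finsum_mem_eq_sum_of_iff {ι M : Type*} [AddCommMonoid M] {P : ι → Prop} {s : Finset ι}
    (h : ∀ i, P i ↔ i ∈ s) (f : ι → M) : ∑ᶠ (i : ι) (_ : P i), f i = ∑ i ∈ s, f i := by
  simp_rw [h]
  exact finsum_mem_finset_eq_sum f s

theorem finprod_mem_eq_prod_of_iff {ι M : Type*} [CommMonoid M] {P : ι → Prop} {s : Finset ι}
    (h : ∀ i, P i ↔ i ∈ s) (f : ι → M) : ∏ᶠ (i : ι) (_ : P i), f i = ∏ i ∈ s, f i := by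
  simp_rw [h]
  exact finprod_mem_finset_eq_prod f s

theorem right_pos_iff (hθ : StrictMono θ) (hneg : θ (-1) < 0) (hpos : 0 < θ 0) (k : ℤ) :
    0 < θ (2 * k) ↔ 0 ≤ k := by
  refine ⟨fun h => ?_, fun h => hpos.trans_le (hθ.monotone (by lia))⟩
  have : -1 < 2 * k := hθ.lt_iff_lt.1 (hneg.trans h)
  lia

theorem right_neg_iff (hθ : StrictMono θ) (hneg : θ (-1) < 0) (hpos : 0 < θ 0) (k : ℤ) :
    θ (2 * k) < 0 ↔ k < 0 := by
  refine ⟨fun h => ?_, fun h => (hθ.monotone (by lia)).trans_lt hneg⟩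
  by_contra! hk
  exact h.not_gt ((right_pos_iff hθ hneg hpos k).2 hk)

theorem impulseMoment_of_nonneg (hθ : StrictMono θ) (hneg : θ (-1) < 0) (hpos : 0 < θ 0) {k : ℤ}
    (hk : 0 ≤ k) :
    impulseMoment θ k = θ (2 * k) - ∑ j ∈ Finset.Ico 0 k, gapLength θ j := by
  rw [impulseMoment, psi, if_pos ((right_pos_iff hθ hneg hpos k).2 hk).le,
    finsum_mem_eq_sum_of_iff (s := Finset.Ico 0 k)]
  intro j
  rw [right_pos_iff hθ hneg hpos, hθ.lt_iff_lt, Finset.mem_Ico]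
  lia

theorem impulseMoment_of_neg (hθ : StrictMono θ) (hneg : θ (-1) < 0) (hpos : 0 < θ 0) {k : ℤ}
    (hk : k < 0) :
    impulseMoment θ k = θ (2 * k) + ∑ j ∈ Finset.Ico k 0, gapLength θ j := by
  rw [impulseMoment, psi, if_neg ((right_neg_iff hθ hneg hpos k).2 hk).not_ge,
    finsum_mem_eq_sum_of_iff (s := Finset.Ico k 0)]
  intro j
  rw [right_neg_iff hθ hneg hpos, hθ.le_iff_le, Finset.mem_Ico]
  lia

/-- The substitution deletes the gaps, so consecutive impulse moments differ by the length of the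
interval between them. The case `k = -1` is where the two branches of `psi` meet. -/
theorem impulseMoment_add_one (hθ : StrictMono θ) (hneg : θ (-1) < 0) (hpos : 0 < θ 0) (k : ℤ) :
    impulseMoment θ (k + 1) = impulseMoment θ k + (θ (2 * k + 2) - θ (2 * k + 1)) := by
  rcases lt_trichotomy k (-1) with hk | rfl | hk
  · rw [impulseMoment_of_neg hθ hneg hpos (by lia), impulseMoment_of_neg hθ hneg hpos (by lia),
      ← Finset.insert_Ico_add_one_left_eq_Ico (show k < 0 by lia), Finset.sum_insert (by simp),
      gapLength, mul_add, mul_one]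
    ring
  · rw [impulseMoment_of_neg (k := -1) hθ hneg hpos (by lia),
      impulseMoment_of_nonneg (k := -1 + 1) hθ hneg hpos (by lia)]
    have : Finset.Ico (-1 : ℤ) 0 = {-1} := rfl
    rw [this]
    simp [gapLength]
  · rw [impulseMoment_of_nonneg hθ hneg hpos (by lia), impulseMoment_of_nonneg hθ hneg hpos
      (by lia), ← Finset.insert_Ico_right_eq_Ico_add_one (show 0 ≤ k by lia),
      Finset.sum_insert (by simp), gapLength, mul_add, mul_one]
    ring

theorem impulseMoment_strictMono (hθ : StrictMono θ) (hneg : θ (-1) < 0) (hpos : 0 < θ 0) :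
    StrictMono (impulseMoment θ) :=
  strictMono_int_of_lt_succ fun k => by
    rw [impulseMoment_add_one hθ hneg hpos]
    linarith [hθ (show 2 * k + 1 < 2 * k + 2 by lia)]

theorem impulseMoment_add_period (hθ : StrictMono θ) (hneg : θ (-1) < 0) (hpos : 0 < θ 0)
    {ω : ℝ} (hω : 0 < ω) {p : ℕ} (hshift : ∀ k, θ (k + 2 * p) = θ k + ω) (k : ℤ) :
    impulseMoment θ (k + p) = impulseMoment θ k + psi θ ω := by
  induction k using Int.induction_on with
  | zero =>
    have hψ : psi θ ω = ω - ∑ j ∈ Finset.Ico 0 (p : ℤ), gapLength θ j := by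
      rw [psi, if_pos hω.le, finsum_mem_eq_sum_of_iff (s := Finset.Ico 0 (p : ℤ))]
      intro j
      rw [right_pos_iff hθ hneg hpos, Finset.mem_Ico]
      -- The gaps counted by `psi θ ω` are those with `0 ≤ j < p`: `θ (-1) < 0 < θ 0` shifts to `θ
      -- (2p - 1) < ω < θ (2p)`.
      refine and_congr_right fun _ => ⟨fun h => ?_, fun h => ?_⟩
      · have h1 := hshift 0
        rw [zero_add] at h1
        have : 2 * j < 2 * (p : ℤ) := hθ.lt_iff_lt.1 (by linarith)
        lia
      · have h1 := hshift (-1)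
        have : θ (2 * j) < θ (-1 + 2 * p) := hθ (by lia)
        linarith
    have h0 := hshift 0
    rw [zero_add] at h0
    rw [zero_add, impulseMoment_of_nonneg hθ hneg hpos (by positivity),
      impulseMoment_of_nonneg hθ hneg hpos le_rfl, hψ, h0]
    simp
    ring
  | succ i ih =>
    rw [add_right_comm, impulseMoment_add_one hθ hneg hpos, ih,
      impulseMoment_add_one hθ hneg hpos]
    have h1 := hshift (2 * i + 1)
    have h2 := hshift (2 * i + 2)
    rw [show 2 * ((i : ℤ) + p) + 2 = 2 * i + 2 + 2 * p by ring,
      show 2 * ((i : ℤ) + p) + 1 = 2 * i + 1 + 2 * p by ring, h1, h2]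
    ring
  | pred i ih =>
    have h3 := impulseMoment_add_one hθ hneg hpos (-(i : ℤ) - 1)
    have h4 := impulseMoment_add_one hθ hneg hpos (-(i : ℤ) - 1 + p)
    have h1 := hshift (2 * (-(i : ℤ) - 1) + 1)
    have h2 := hshift (2 * (-(i : ℤ) - 1) + 2)
    rw [show -(i : ℤ) - 1 + p + 1 = -i + p by ring, ih,
      show 2 * (-(i : ℤ) - 1 + p) + 2 = 2 * (-(i : ℤ) - 1) + 2 + 2 * p by ring,
      show 2 * (-(i : ℤ) - 1 + p) + 1 = 2 * (-(i : ℤ) - 1) + 1 + 2 * p by ring, h1, h2] at h4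
    rw [sub_add_cancel] at h3
    linarith

theorem psi_period_pos (hθ : StrictMono θ) (hneg : θ (-1) < 0) (hpos : 0 < θ 0)
    {ω : ℝ} (hω : 0 < ω) {p : ℕ} (hp : 0 < p) (hshift : ∀ k, θ (k + 2 * p) = θ k + ω) :
    0 < psi θ ω := by
  have h := impulseMoment_add_period hθ hneg hpos hω hshift 0
  have := impulseMoment_strictMono hθ hneg hpos (show (0 : ℤ) < 0 + p by lia)
  linarith

theorem gapLength_le_maxGap {ω : ℝ} {p : ℕ} (hp : 0 < p)
    (hshift : ∀ k, θ (k + 2 * p) = θ k + ω) (k : ℤ) : gapLength θ k ≤ maxGap θ p := by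
  have hper : Function.Periodic (gapLength θ) (p : ℤ) := fun k => by
    rw [gapLength, gapLength, show 2 * (k + (p : ℤ)) + 1 = 2 * k + 1 + 2 * p by ring, mul_add,
      hshift, hshift, add_sub_add_right_eq_sub]
  obtain ⟨j, hj, hj'⟩ := hper.exists_mem_Ico₀ (by exact_mod_cast hp) k
  rw [hj']
  lift j to ℕ using hj.1
  have hjp : j < p := by exact_mod_cast hj.2
  exact le_ciSup (f := fun k : Fin p => gapLength θ ((k : ℕ) : ℤ)) (Set.finite_range _).bddAbove
    ⟨j, hjp⟩

/-- The value of the `ψ`-substitution at the point `t` of the `k`-th interval of the time scale,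
extended to the left end point by its right limit. -/
def clock (θ : ℤ → ℝ) (k : ℤ) (t : ℝ) : ℝ := impulseMoment θ k - (θ (2 * k) - t)

theorem clock_right (k : ℤ) : clock θ k (θ (2 * k)) = impulseMoment θ k := by simp [clock]

theorem clock_sub_clock (k : ℤ) (t u : ℝ) : clock θ k t - clock θ k u = t - u := by
  simp only [clock]; ring

theorem clock_left_add_one (hθ : StrictMono θ) (hneg : θ (-1) < 0) (hpos : 0 < θ 0) (k : ℤ) :
    clock θ (k + 1) (θ (2 * k + 1)) = impulseMoment θ k := by
  rw [clock, impulseMoment_add_one hθ hneg hpos, mul_add, mul_one]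
  ring

theorem clock_left (hθ : StrictMono θ) (hneg : θ (-1) < 0) (hpos : 0 < θ 0) (k : ℤ) :
    clock θ k (θ (2 * k - 1)) = impulseMoment θ (k - 1) := by
  rw [← clock_left_add_one hθ hneg hpos, sub_add_cancel]
  congr 2
  ring

theorem clock_mem (hθ : StrictMono θ) (hneg : θ (-1) < 0) (hpos : 0 < θ 0) {k : ℤ} {t : ℝ}
    (ht : t ∈ Icc (θ (2 * k - 1)) (θ (2 * k))) :
    clock θ k t ∈ Icc (impulseMoment θ (k - 1)) (impulseMoment θ k) := by
  rw [← clock_left hθ hneg hpos, ← clock_right]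
  constructor <;> simp only [clock] <;> linarith [ht.1, ht.2]

/-- The flow of `x' = A x`. -/
def flow {E : Type*} [NormedAddCommGroup E] [NormedSpace ℝ E] (A : E →L[ℝ] E) (t : ℝ) :
    E →L[ℝ] E := NormedSpace.exp (t • A)

/-- The product of the jump maps `I + δᵢ A` over `k ≤ i < l`. -/
def jumpProd {E : Type*} [NormedAddCommGroup E] [NormedSpace ℝ E] (θ : ℤ → ℝ) (A : E →L[ℝ] E)
    (k l : ℤ) : E →L[ℝ] E :=
  Polynomial.aeval A (∏ i ∈ Finset.Ico k l,
    (1 + Polynomial.C (gapLength θ i) * Polynomial.X : Polynomial ℝ))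

theorem toEuclideanCLM_exp {n : ℕ} (M : Matrix (Fin n) (Fin n) ℝ) :
    Matrix.toEuclideanCLM (n := Fin n) (𝕜 := ℝ) (NormedSpace.exp M)
      = NormedSpace.exp (Matrix.toEuclideanCLM (n := Fin n) (𝕜 := ℝ) M) := by
  open scoped Matrix.Norms.L2Operator in
  let : NormedAlgebra ℚ (Matrix (Fin n) (Fin n) ℝ) := NormedAlgebra.restrictScalars ℚ ℝ _
  open scoped Matrix.Norms.L2Operator in
  exact NormedSpace.map_exp (Matrix.toEuclideanCLM (n := Fin n) (𝕜 := ℝ))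
    (LinearMap.continuous_of_finiteDimensional
      (Matrix.toEuclideanCLM (n := Fin n) (𝕜 := ℝ)).toAlgEquiv.toLinearMap) M

/-- The left ends are excluded because the clock sends `θ (2 * k - 1)` to the impulse moment `k -
1`, where the left-continuous transition matrix sees the state before the jump. -/
theorem toEuclideanCLM_transitionMatrix (hθ : StrictMono θ) (hneg : θ (-1) < 0) (hpos : 0 < θ 0)
    {n : ℕ} (A : Matrix (Fin n) (Fin n) ℝ) {k l : ℤ} {t u : ℝ}
    (ht : t ∈ Ioc (θ (2 * k - 1)) (θ (2 * k))) (hu : u ∈ Ioc (θ (2 * l - 1)) (θ (2 * l))) :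
    Matrix.toEuclideanCLM (n := Fin n) (𝕜 := ℝ) (transitionMatrix θ A (clock θ l u) (clock θ k t))
      = flow (Matrix.toEuclideanCLM (n := Fin n) (𝕜 := ℝ) A) (clock θ l u - clock θ k t)
        * jumpProd θ (Matrix.toEuclideanCLM (n := Fin n) (𝕜 := ℝ) A) k l := by
  have hmono := impulseMoment_strictMono hθ hneg hpos
  have hlt : ∀ {k : ℤ} {t : ℝ}, t ∈ Ioc (θ (2 * k - 1)) (θ (2 * k)) →
      impulseMoment θ (k - 1) < clock θ k t := fun {k t} ht => by
    rw [← clock_left hθ hneg hpos]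
    simp only [clock]
    linarith [ht.1]
  rw [transitionMatrix, finprod_mem_eq_prod_of_iff (s := Finset.Ico k l), map_mul,
    toEuclideanCLM_exp, map_smul, flow, jumpProd]
  · congr 1
    exact (Polynomial.aeval_algHom_apply
      (Matrix.toEuclideanCLM (n := Fin n) (𝕜 := ℝ)).toAlgEquiv.toAlgHom A _).symm
  · intro i
    rw [Finset.mem_Ico]
    refine and_congr ⟨fun h => ?_, fun h => ?_⟩ ⟨fun h => ?_, fun h => ?_⟩
    · have := hmono.lt_iff_lt.1 ((hlt ht).trans_le h)
      lia
    · exact (clock_mem hθ hneg hpos (Ioc_subset_Icc_self ht)).2.trans (hmono.monotone h)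
    · exact hmono.lt_iff_lt.1 (h.trans_le (clock_mem hθ hneg hpos (Ioc_subset_Icc_self hu)).2)
    · exact (hmono.monotone (by lia)).trans_lt (hlt hu)

theorem continuous_flow {E : Type*} [NormedAddCommGroup E] [NormedSpace ℝ E] [CompleteSpace E]
    (A : E →L[ℝ] E) : Continuous (flow A) :=
  continuous_iff_continuousAt.2 fun t => (hasDerivAt_exp_smul_const A t).continuousAt

/-- The given decay bound extends to left end points, that is, to states just after a jump, by
letting interior points tend to them. -/
theorem norm_flow_mul_jumpProd_le (hθ : StrictMono θ) (hneg : θ (-1) < 0) (hpos : 0 < θ 0)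
    {n : ℕ} (A : Matrix (Fin n) (Fin n) ℝ) {N lam : ℝ}
    (hX : ∀ s r : ℝ, r ≤ s →
      matNorm (transitionMatrix θ A s r) ≤ N * Real.exp (-lam * (s - r)))
    {k l : ℤ} (hkl : k ≤ l) {t u : ℝ}
    (ht : t ∈ Icc (θ (2 * k - 1)) (θ (2 * k))) (hu : u ∈ Icc (θ (2 * l - 1)) (θ (2 * l)))
    (htu : clock θ k t ≤ clock θ l u) :
    ‖flow (Matrix.toEuclideanCLM (n := Fin n) (𝕜 := ℝ) A) (clock θ l u - clock θ k t)
        * jumpProd θ (Matrix.toEuclideanCLM (n := Fin n) (𝕜 := ℝ) A) k l‖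
      ≤ N * Real.exp (-lam * (clock θ l u - clock θ k t)) := by
  set B := Matrix.toEuclideanCLM (n := Fin n) (𝕜 := ℝ) A
  -- Both times are pushed towards the right ends of their intervals by the same proportion `η`,
  -- which leaves the left ends at once and keeps the order of two points of one interval.
  let T : ℝ → ℝ := fun η => t + η * (θ (2 * k) - t)
  let U : ℝ → ℝ := fun η => u + η * (θ (2 * l) - u)
  let G : ℝ → ℝ := fun η => clock θ l (U η) - clock θ k (T η)
  have hG : Continuous G := by simp only [G, T, U, clock]; fun_prop
  have hmove : ∀ {k : ℤ} {t : ℝ}, t ∈ Icc (θ (2 * k - 1)) (θ (2 * k)) → ∀ η ∈ Ioo (0 : ℝ) 1,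
      t + η * (θ (2 * k) - t) ∈ Ioc (θ (2 * k - 1)) (θ (2 * k)) := fun {k t} ht η hη => by
    have := left_lt_right hθ k
    constructor
    · rcases ht.1.eq_or_lt with h | h
      · rw [← h]
        nlinarith [mul_pos hη.1 (sub_pos.2 this)]
      · nlinarith [mul_nonneg hη.1.le (sub_nonneg.2 ht.2)]
    · nlinarith [mul_nonneg (sub_nonneg.2 hη.2.le) (sub_nonneg.2 ht.2)]
  have key : ∀ η ∈ Ioo (0 : ℝ) 1,
      ‖flow B (G η) * jumpProd θ B k l‖ ≤ N * Real.exp (-lam * G η) := by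
    intro η hη
    have h1 := hmove ht η hη
    have h2 := hmove hu η hη
    rw [← toEuclideanCLM_transitionMatrix hθ hneg hpos A h1 h2]
    refine hX _ _ ?_
    rcases hkl.eq_or_lt with rfl | hlt
    · have h3 : t ≤ u := by simp only [clock] at htu; linarith
      simp only [clock]
      nlinarith [mul_nonneg (sub_nonneg.2 hη.2.le) (sub_nonneg.2 h3)]
    · exact ((clock_mem hθ hneg hpos (Ioc_subset_Icc_self h1)).2.trans
        ((impulseMoment_strictMono hθ hneg hpos).monotone (by lia))).trans
        (clock_mem hθ hneg hpos (Ioc_subset_Icc_self h2)).1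
  have hG0 : G 0 = clock θ l u - clock θ k t := by simp [G, T, U]
  rw [← hG0]
  have hc1 : Continuous fun η => ‖flow B (G η) * jumpProd θ B k l‖ :=
    (((continuous_flow B).comp hG).mul continuous_const).norm
  have hc2 : Continuous fun η => N * Real.exp (-lam * G η) := by fun_prop
  exact le_of_tendsto_of_tendsto (hc1.continuousWithinAt (s := Ioi 0))
    (hc2.continuousWithinAt (s := Ioi 0))
    (mem_of_superset (Ioo_mem_nhdsGT one_pos) key)

end Clock

/-! ### Variation of constants and a norm in which the linear system contracts. -/

section AdaptedNorm

variable {θ : ℤ → ℝ} {E : Type*} [NormedAddCommGroup E] [NormedSpace ℝ E]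

theorem IntervalIntegrable.continuous_clm_apply {φ : ℝ → E →L[ℝ] E} {h : ℝ → E} {a b : ℝ}
    (hh : IntervalIntegrable h MeasureTheory.volume a b) (hφ : Continuous φ) :
    IntervalIntegrable (fun v => φ v (h v)) MeasureTheory.volume a b := by
  obtain ⟨C, hC⟩ := isCompact_uIcc.exists_bound_of_continuousOn (s := uIcc a b) hφ.continuousOn
  rw [intervalIntegrable_iff] at hh ⊢
  refine (hh.norm.const_mul C).mono' ?_ ?_
  · exact (ContinuousLinearMap.id ℝ (E →L[ℝ] E)).aestronglyMeasurable_comp₂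
      hφ.aestronglyMeasurable hh.aestronglyMeasurable
  · filter_upwards [MeasureTheory.ae_restrict_mem measurableSet_uIoc] with v hv
    exact (φ v).le_of_opNorm_le (hC v (uIoc_subset_uIcc hv)) _

/-- The solution with value `w` at `a` of `x' = A x + h`. -/
def duhamel (A : E →L[ℝ] E) (a : ℝ) (w : E) (h : ℝ → E) (t : ℝ) : E :=
  flow A (t - a) w + ∫ v in a..t, flow A (t - v) (h v)

theorem flow_zero (A : E →L[ℝ] E) : flow A 0 = 1 := by simp [flow]

theorem jumpProd_self (A : E →L[ℝ] E) (k : ℤ) : jumpProd θ A k k = 1 := by simp [jumpProd]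

theorem jumpProd_eq_mul_add_one (A : E →L[ℝ] E) {k l : ℤ} (h : k < l) :
    jumpProd θ A k l = jumpProd θ A (k + 1) l * (1 + gapLength θ k • A) := by
  rw [jumpProd, jumpProd, ← Finset.insert_Ico_add_one_left_eq_Ico h, Finset.prod_insert (by simp),
    mul_comm, map_mul]
  congr 1
  simp [Algebra.smul_def]

theorem commute_jumpProd_flow (A : E →L[ℝ] E) (k l : ℤ) (t : ℝ) :
    Commute (jumpProd θ A k l) (flow A t) := by
  let : NormedAlgebra ℚ (E →L[ℝ] E) := NormedAlgebra.restrictScalars ℚ ℝ _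
  have h : Commute (jumpProd θ A k l) A := by
    have := Polynomial.aeval_X (R := ℝ) A
    unfold jumpProd
    nth_rewrite 2 [← this]
    rw [Commute, SemiconjBy, ← map_mul, ← map_mul, mul_comm]
  exact (h.smul_right t).exp_right

/-- The future points of the time scale, seen from the point `t` of the `k`-th interval. -/
def futurePoints (θ : ℤ → ℝ) (k : ℤ) (t : ℝ) : Set (ℤ × ℝ) :=
  {q | k ≤ q.1 ∧ q.2 ∈ Icc (θ (2 * q.1 - 1)) (θ (2 * q.1)) ∧ clock θ k t ≤ clock θ q.1 q.2}

/-- The norm at the point `t` of the `k`-th interval for which the impulsive system contracts with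
rate `lam`. -/
def adaptedNorm (θ : ℤ → ℝ) (A : E →L[ℝ] E) (lam : ℝ) (k : ℤ) (t : ℝ) (x : E) : ℝ :=
  ⨆ q : futurePoints θ k t, Real.exp (lam * (clock θ q.1.1 q.1.2 - clock θ k t)) *
    ‖(flow A (clock θ q.1.1 q.1.2 - clock θ k t) * jumpProd θ A k q.1.1) x‖

theorem self_mem_futurePoints {k : ℤ} {t : ℝ} (ht : t ∈ Icc (θ (2 * k - 1)) (θ (2 * k))) :
    (k, t) ∈ futurePoints θ k t := ⟨le_rfl, ht, le_rfl⟩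

theorem adaptedNorm_le {A : E →L[ℝ] E} {lam : ℝ} {k : ℤ} {t : ℝ}
    (ht : t ∈ Icc (θ (2 * k - 1)) (θ (2 * k))) {x : E} {M : ℝ}
    (h : ∀ q : futurePoints θ k t, Real.exp (lam * (clock θ q.1.1 q.1.2 - clock θ k t)) *
      ‖(flow A (clock θ q.1.1 q.1.2 - clock θ k t) * jumpProd θ A k q.1.1) x‖ ≤ M) :
    adaptedNorm θ A lam k t x ≤ M :=
  have : Nonempty (futurePoints θ k t) := ⟨_, self_mem_futurePoints ht⟩
  ciSup_le h

/-- The impulsive system decays with rate `lam`, up to the factor `N`. -/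
def ImpulsiveDecay (θ : ℤ → ℝ) (A : E →L[ℝ] E) (N lam : ℝ) : Prop :=
  ∀ k l : ℤ, k ≤ l → ∀ t ∈ Icc (θ (2 * k - 1)) (θ (2 * k)),
    ∀ u ∈ Icc (θ (2 * l - 1)) (θ (2 * l)), clock θ k t ≤ clock θ l u →
      ‖flow A (clock θ l u - clock θ k t) * jumpProd θ A k l‖
        ≤ N * Real.exp (-lam * (clock θ l u - clock θ k t))

variable {A : E →L[ℝ] E} {N lam : ℝ} {k : ℤ} {t : ℝ}

theorem ImpulsiveDecay.apply_le (hA : ImpulsiveDecay θ A N lam)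
    (ht : t ∈ Icc (θ (2 * k - 1)) (θ (2 * k))) (x : E) (q : futurePoints θ k t) :
    Real.exp (lam * (clock θ q.1.1 q.1.2 - clock θ k t)) *
      ‖(flow A (clock θ q.1.1 q.1.2 - clock θ k t) * jumpProd θ A k q.1.1) x‖ ≤ N * ‖x‖ := by
  have h := (flow A (clock θ q.1.1 q.1.2 - clock θ k t) * jumpProd θ A k q.1.1).le_of_opNorm_le
    (hA k q.1.1 q.2.1 t ht q.1.2 q.2.2.1 q.2.2.2) x
  calc _ ≤ Real.exp (lam * (clock θ q.1.1 q.1.2 - clock θ k t)) *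
        (N * Real.exp (-lam * (clock θ q.1.1 q.1.2 - clock θ k t)) * ‖x‖) := by gcongr
    _ = (Real.exp (lam * (clock θ q.1.1 q.1.2 - clock θ k t)) *
          Real.exp (-lam * (clock θ q.1.1 q.1.2 - clock θ k t))) * (N * ‖x‖) := by ring
    _ = N * ‖x‖ := by rw [← Real.exp_add, neg_mul, add_neg_cancel, Real.exp_zero, one_mul]

theorem ImpulsiveDecay.le_adaptedNorm (hA : ImpulsiveDecay θ A N lam)
    (ht : t ∈ Icc (θ (2 * k - 1)) (θ (2 * k))) (x : E) {l : ℤ} {u : ℝ}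
    (hq : (l, u) ∈ futurePoints θ k t) :
    Real.exp (lam * (clock θ l u - clock θ k t)) *
      ‖(flow A (clock θ l u - clock θ k t) * jumpProd θ A k l) x‖ ≤ adaptedNorm θ A lam k t x :=
  le_ciSup (f := fun q : futurePoints θ k t =>
    Real.exp (lam * (clock θ q.1.1 q.1.2 - clock θ k t)) *
      ‖(flow A (clock θ q.1.1 q.1.2 - clock θ k t) * jumpProd θ A k q.1.1) x‖)
    ⟨N * ‖x‖, by rintro _ ⟨q, rfl⟩; exact hA.apply_le ht x q⟩ ⟨(l, u), hq⟩

theorem ImpulsiveDecay.adaptedNorm_le_mul_norm (hA : ImpulsiveDecay θ A N lam)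
    (ht : t ∈ Icc (θ (2 * k - 1)) (θ (2 * k))) (x : E) :
    adaptedNorm θ A lam k t x ≤ N * ‖x‖ :=
  adaptedNorm_le ht (hA.apply_le ht x)

theorem ImpulsiveDecay.norm_le_adaptedNorm (hA : ImpulsiveDecay θ A N lam)
    (ht : t ∈ Icc (θ (2 * k - 1)) (θ (2 * k))) (x : E) : ‖x‖ ≤ adaptedNorm θ A lam k t x := by
  simpa [flow_zero, jumpProd_self] using hA.le_adaptedNorm ht x (self_mem_futurePoints ht)

theorem ImpulsiveDecay.adaptedNorm_add_le (hA : ImpulsiveDecay θ A N lam)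
    (ht : t ∈ Icc (θ (2 * k - 1)) (θ (2 * k))) (x y : E) :
    adaptedNorm θ A lam k t (x + y) ≤ adaptedNorm θ A lam k t x + adaptedNorm θ A lam k t y := by
  refine adaptedNorm_le ht fun q => ?_
  rw [map_add]
  refine le_trans ?_ (add_le_add (hA.le_adaptedNorm ht x q.2) (hA.le_adaptedNorm ht y q.2))
  rw [← mul_add]
  gcongr
  exact norm_add_le _ _

/-- The two ends of a gap have the same clock value, and the future of the far end belongs to the
future of the near end. The jump factor is already contained in the operators defining the norm at
the near end. -/
theorem ImpulsiveDecay.adaptedNorm_jump_le (hA : ImpulsiveDecay θ A N lam) (hθ : StrictMono θ)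
    (hneg : θ (-1) < 0) (hpos : 0 < θ 0) (k : ℤ) (x : E) :
    adaptedNorm θ A lam (k + 1) (θ (2 * k + 1)) (x + gapLength θ k • A x)
      ≤ adaptedNorm θ A lam k (θ (2 * k)) x := by
  have hclock : clock θ (k + 1) (θ (2 * k + 1)) = clock θ k (θ (2 * k)) := by
    rw [clock_left_add_one hθ hneg hpos, clock_right]
  have hm : θ (2 * k + 1) ∈ Icc (θ (2 * (k + 1) - 1)) (θ (2 * (k + 1))) :=
    ⟨(congrArg θ (by ring)).le, hθ.monotone (by lia)⟩
  refine adaptedNorm_le hm fun q => ?_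
  obtain ⟨⟨l, u⟩, h1, h2, h3⟩ := q
  simp only at h1 h2 h3
  have := hA.le_adaptedNorm (right_mem_Icc.2 (left_lt_right hθ k).le) x (l := l) (u := u)
    ⟨by lia, h2, hclock ▸ h3⟩
  rw [jumpProd_eq_mul_add_one A (by lia), ← hclock, ← mul_assoc] at this
  exact this

theorem integral_exp_mul_exp {a t lam μ : ℝ} (h : μ ≠ lam) :
    ∫ v in a..t, Real.exp (-lam * (t - v)) * Real.exp (-μ * (v - a))
      = (Real.exp (-μ * (t - a)) - Real.exp (-lam * (t - a))) / (lam - μ) := by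
  have h0 : lam - μ ≠ 0 := sub_ne_zero.2 h.symm
  rw [intervalIntegral.integral_eq_sub_of_hasDerivAt
    (f := fun v => Real.exp (-lam * (t - v) + -μ * (v - a)) / (lam - μ))]
  · simp [sub_div]
  · intro v _
    have h1 : HasDerivAt (fun v => -lam * (t - v) + -μ * (v - a)) (lam - μ) v :=
      (((hasDerivAt_id v).const_sub t).const_mul (-lam)).add
        (((hasDerivAt_id v).sub_const a).const_mul (-μ)) |>.congr_deriv (by ring)
    refine (h1.exp.div_const (lam - μ)).congr_deriv ?_
    rw [Real.exp_add]
    field_simp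
  · exact Continuous.intervalIntegrable (by fun_prop) _ _

variable [CompleteSpace E]

theorem flow_add (A : E →L[ℝ] E) (s t : ℝ) : flow A (s + t) = flow A s * flow A t := by
  let : NormedAlgebra ℚ (E →L[ℝ] E) := NormedAlgebra.restrictScalars ℚ ℝ _
  rw [flow, add_smul, NormedSpace.exp_add_of_commute]
  · rfl
  · exact ((Commute.refl A).smul_left s).smul_right t

theorem duhamel_sub (A : E →L[ℝ] E) {a t : ℝ} (w w' : E) {h h' : ℝ → E}
    (hh : IntervalIntegrable h MeasureTheory.volume a t)
    (hh' : IntervalIntegrable h' MeasureTheory.volume a t) :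
    duhamel A a w h t - duhamel A a w' h' t
      = duhamel A a (w - w') (fun v => h v - h' v) t := by
  have hc : Continuous fun v => flow A (t - v) := (continuous_flow A).comp (by fun_prop)
  simp only [duhamel, map_sub]
  rw [intervalIntegral.integral_sub (hh.continuous_clm_apply hc) (hh'.continuous_clm_apply hc)]
  abel

theorem flow_jumpProd_duhamel (A : E →L[ℝ] E) (k l : ℤ) {a t : ℝ} (s : ℝ) (w : E) {h : ℝ → E}
    (hh : IntervalIntegrable h MeasureTheory.volume a t) :
    (flow A s * jumpProd θ A k l) (duhamel A a w h t)
      = (flow A (s + (t - a)) * jumpProd θ A k l) w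
        + ∫ v in a..t, (flow A (s + (t - v)) * jumpProd θ A k l) (h v) := by
  have hc : Continuous fun v => flow A (t - v) := (continuous_flow A).comp (by fun_prop)
  have hcomm : ∀ r, flow A (s + r) * jumpProd θ A k l
      = flow A s * jumpProd θ A k l * flow A r := fun r => by
    rw [flow_add, mul_assoc, mul_assoc, (commute_jumpProd_flow A k l r).eq]
  rw [duhamel, map_add, ← ContinuousLinearMap.intervalIntegral_comp_comm _
    (hh.continuous_clm_apply hc)]
  simp only [hcomm]
  rfl

/-- Each future operator is moved inside Duhamel's formula. The homogeneous part decays with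
constant 1, being a supremum over a smaller future; the factor `N` is paid on the inhomogeneity
only. The rate `μ` in the bound on `h` leaves room for the weight introduced later. -/
theorem ImpulsiveDecay.adaptedNorm_duhamel_le (hA : ImpulsiveDecay θ A N lam) (hN : 0 ≤ N)
    {μ M : ℝ} (hμ : μ < lam)
    (ht : t ∈ Icc (θ (2 * k - 1)) (θ (2 * k))) (w : E) {h : ℝ → E}
    (hh : IntervalIntegrable h MeasureTheory.volume (θ (2 * k - 1)) t)
    (hM : ∀ v ∈ Icc (θ (2 * k - 1)) t, ‖h v‖ ≤ M * Real.exp (-μ * (v - θ (2 * k - 1)))) :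
    adaptedNorm θ A lam k t (duhamel A (θ (2 * k - 1)) w h t)
      ≤ Real.exp (-lam * (t - θ (2 * k - 1))) * adaptedNorm θ A lam k (θ (2 * k - 1)) w
        + N * M * ((Real.exp (-μ * (t - θ (2 * k - 1))) - Real.exp (-lam * (t - θ (2 * k - 1))))
          / (lam - μ)) := by
  set a := θ (2 * k - 1) with ha
  have hat : a ≤ t := ht.1
  refine adaptedNorm_le ht fun q => ?_
  obtain ⟨⟨l, u⟩, h1, h2, h3⟩ := q
  simp only at h1 h2 h3 ⊢
  set Δ := clock θ l u - clock θ k t with hΔ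
  have hv : ∀ v, Δ + (t - v) = clock θ l u - clock θ k v := fun v => by
    rw [hΔ, ← clock_sub_clock k t v]; ring
  have hmem : ∀ v ∈ Icc a t, v ∈ Icc (θ (2 * k - 1)) (θ (2 * k)) := fun v hv =>
    ⟨hv.1, hv.2.trans ht.2⟩
  have hle : ∀ v ∈ Icc a t, clock θ k v ≤ clock θ l u := fun v hv => by
    refine le_trans ?_ h3
    simp only [clock]; linarith [hv.2]
  have e1 : Real.exp (lam * Δ) * ‖(flow A (Δ + (t - a)) * jumpProd θ A k l) w‖
      ≤ Real.exp (-lam * (t - a)) * adaptedNorm θ A lam k a w := by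
    have := hA.le_adaptedNorm (hmem a (left_mem_Icc.2 hat)) w
      ⟨h1, h2, hle a (left_mem_Icc.2 hat)⟩
    rw [← hv] at this
    refine le_trans (le_of_eq ?_) (mul_le_mul_of_nonneg_left this (Real.exp_pos _).le)
    rw [← mul_assoc, ← Real.exp_add]
    congr 2
    ring
  have e2 : ‖∫ v in a..t, (flow A (Δ + (t - v)) * jumpProd θ A k l) (h v)‖
      ≤ ∫ v in a..t, Real.exp (-lam * Δ) * (N * M) *
        (Real.exp (-lam * (t - v)) * Real.exp (-μ * (v - a))) := by
    refine intervalIntegral.norm_integral_le_of_norm_le hat (Eventually.of_forall fun v hv' => ?_)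
      (Continuous.intervalIntegrable (by fun_prop) _ _)
    have hv' : v ∈ Icc a t := Ioc_subset_Icc_self hv'
    have h4 := hA k l h1 v (hmem v hv') u h2 (hle v hv')
    rw [← hv] at h4
    calc _ ≤ N * Real.exp (-lam * (Δ + (t - v))) * (M * Real.exp (-μ * (v - a))) :=
          (ContinuousLinearMap.le_of_opNorm_le _ h4 _).trans
            (mul_le_mul_of_nonneg_left (hM v hv') (by positivity))
      _ = _ := by rw [mul_add, Real.exp_add]; ring
  rw [intervalIntegral.integral_const_mul, integral_exp_mul_exp hμ.ne] at e2
  rw [flow_jumpProd_duhamel A k l Δ w hh]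
  calc _ ≤ Real.exp (lam * Δ) * (‖(flow A (Δ + (t - a)) * jumpProd θ A k l) w‖
          + Real.exp (-lam * Δ) * (N * M) *
            ((Real.exp (-μ * (t - a)) - Real.exp (-lam * (t - a))) / (lam - μ))) := by
        gcongr
        exact (norm_add_le _ _).trans (add_le_add_right e2 _)
    _ = Real.exp (lam * Δ) * ‖(flow A (Δ + (t - a)) * jumpProd θ A k l) w‖
          + (Real.exp (lam * Δ) * Real.exp (-lam * Δ)) * (N * M *
            ((Real.exp (-μ * (t - a)) - Real.exp (-lam * (t - a))) / (lam - μ))) := by ring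
    _ ≤ _ := by
        rw [← Real.exp_add, neg_mul, add_neg_cancel, Real.exp_zero, one_mul]
        exact add_le_add_left e1 _

end AdaptedNorm

/-! ### The weighted norm and the contraction across a gap and an interval. -/

section StepContraction

variable {E : Type*} [NormedAddCommGroup E] [NormedSpace ℝ E]

/-- A family of norms, uniformly equivalent to the given one, that is contracted by the passage
from the end of an interval of the time scale through the next one, for linear equations with
inhomogeneities of size at most `Lf * ‖x‖ + ε`. -/
structure StepContraction (θ : ℤ → ℝ) (A : E →L[ℝ] E) (Lf : ℝ) (ν : ℤ → ℝ → E → ℝ)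
    (c₁ c₂ κ C : ℝ) : Prop where
  c₁_pos : 0 < c₁
  c₂_nonneg : 0 ≤ c₂
  κ_nonneg : 0 ≤ κ
  κ_lt_one : κ < 1
  C_nonneg : 0 ≤ C
  lower : ∀ (k : ℤ), ∀ t ∈ Icc (θ (2 * k - 1)) (θ (2 * k)), ∀ x, c₁ * ‖x‖ ≤ ν k t x
  upper : ∀ (k : ℤ), ∀ t ∈ Icc (θ (2 * k - 1)) (θ (2 * k)), ∀ x, ν k t x ≤ c₂ * ‖x‖
  step : ∀ (k : ℤ) (x₀ h₀ : E) (x h : ℝ → E) (D ε : ℝ), 0 ≤ D → 0 ≤ ε →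
    IntervalIntegrable h MeasureTheory.volume (θ (2 * (k + 1) - 1)) (θ (2 * (k + 1))) →
    ν k (θ (2 * k)) x₀ ≤ D →
    (∀ u ∈ Icc (θ (2 * (k + 1) - 1)) (θ (2 * (k + 1))), ν (k + 1) u (x u) ≤ D) →
    ‖h₀‖ ≤ Lf * ‖x₀‖ + ε →
    (∀ u ∈ Icc (θ (2 * (k + 1) - 1)) (θ (2 * (k + 1))), ‖h u‖ ≤ Lf * ‖x u‖ + ε) →
    ∀ t ∈ Icc (θ (2 * (k + 1) - 1)) (θ (2 * (k + 1))),
      ν (k + 1) t (duhamel A (θ (2 * (k + 1) - 1)) (x₀ + gapLength θ k • (A x₀ + h₀)) h t)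
        ≤ κ * D + C * ε

variable {θ : ℤ → ℝ}

/-- Under the balance condition `μ s_k - b k` is periodic in `k`, hence bounded; this makes the
weighted norms uniformly equivalent to the Euclidean one. -/
theorem exists_weight_bound (hθ : StrictMono θ) (hneg : θ (-1) < 0) (hpos : 0 < θ 0)
    {ω : ℝ} (hω : 0 < ω) {p : ℕ} (hp : 0 < p) (hshift : ∀ k, θ (k + 2 * p) = θ k + ω)
    {b μ : ℝ} (hb : 0 ≤ b) (hμ : 0 ≤ μ) (h : μ * psi θ ω = b * p) :
    ∃ G : ℝ, ∀ k : ℤ, ∀ t ∈ Icc (θ (2 * k - 1)) (θ (2 * k)),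
      |μ * clock θ k t - b * k| ≤ G := by
  have hper : Function.Periodic (fun k : ℤ => |μ * impulseMoment θ k - b * k|) (p : ℤ) :=
    fun k => by
    change |μ * impulseMoment θ (k + p) - b * ((k + p : ℤ) : ℝ)| = |μ * impulseMoment θ k - b * k|
    rw [impulseMoment_add_period hθ hneg hpos hω hshift]
    congr 1
    rw [Int.cast_add, Int.cast_natCast]
    linear_combination h
  obtain ⟨G, hG⟩ := ((finite_Ico (0 : ℤ) p).image
    (fun k : ℤ => |μ * impulseMoment θ k - b * k|)).bddAbove
  have hG' : ∀ k : ℤ, |μ * impulseMoment θ k - b * k| ≤ G := fun k => by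
    obtain ⟨j, hj, hj'⟩ := hper.exists_mem_Ico₀ (by exact_mod_cast hp) k
    exact hj'.le.trans <| hG ⟨j, hj, rfl⟩
  refine ⟨G + b, fun k t ht => ?_⟩
  have h1 := clock_mem hθ hneg hpos ht
  have h2 := abs_le.1 (hG' k)
  have h3 := abs_le.1 (hG' (k - 1))
  have h4 := mul_le_mul_of_nonneg_left h1.1 hμ
  have h5 := mul_le_mul_of_nonneg_left h1.2 hμ
  push_cast at h3
  rw [abs_le]
  constructor <;> linarith [h3.1, h2.2]

variable [CompleteSpace E]

theorem ImpulsiveDecay.exists_stepContraction {A : E →L[ℝ] E} {N lam : ℝ}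
    (hA : ImpulsiveDecay θ A N lam) (hN : 0 < N) (hθ : StrictMono θ) (hneg : θ (-1) < 0)
    (hpos : 0 < θ 0) {ω : ℝ} (hω : 0 < ω) {p : ℕ} (hp : 0 < p)
    (hshift : ∀ k, θ (k + 2 * p) = θ k + ω) {Lf : ℝ} (hLf : 0 < Lf)
    (hC6 : -lam + N * Lf + p / psi θ ω * Real.log (1 + N * Lf * maxGap θ p) < 0) :
    ∃ ν c₁ c₂ κ C, StepContraction θ A Lf ν c₁ c₂ κ C := by
  have hψ : 0 < psi θ ω := psi_period_pos hθ hneg hpos hω hp hshift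
  have hp' : (0 : ℝ) < p := by exact_mod_cast hp
  set δ := maxGap θ p
  have hδ : ∀ k, gapLength θ k ≤ δ := gapLength_le_maxGap hp hshift
  have hδ0 : 0 < δ := (gapLength_pos hθ 0).trans_le (hδ 0)
  have hδ1 : 1 < 1 + N * Lf * δ := by linarith [mul_pos (mul_pos hN hLf) hδ0]
  set ℓ := Real.log (1 + N * Lf * δ)
  have hℓ : 0 < ℓ := Real.log_pos hδ1
  have hℓ' : ℓ < (lam - N * Lf) * psi θ ω / p := by
    rw [lt_div_iff₀ hp']
    have : p / psi θ ω * ℓ * psi θ ω = ℓ * p := by field_simp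
    nlinarith [mul_lt_mul_of_pos_right hC6 hψ]
  -- Here (C6) enters: `b` exceeds the logarithmic cost of a jump but stays below the average
  -- surplus of decay per gap. Then `q < 1` controls the jumps and `r < 1` the intervals.
  obtain ⟨b, hb1, hb2⟩ := exists_between hℓ'
  have hb : 0 < b := hℓ.trans hb1
  set μ := b * p / psi θ ω with hμ_def
  have hμψ : μ * psi θ ω = b * p := div_mul_cancel₀ _ hψ.ne'
  have hμ0 : 0 < μ := by positivity
  have hμ : N * Lf < lam - μ := by
    have : b * p < (lam - N * Lf) * psi θ ω := (lt_div_iff₀ hp').1 hb2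
    have : μ < lam - N * Lf := (div_lt_iff₀ hψ).2 this
    linarith
  have hlμ : 0 < lam - μ := (by positivity : 0 < N * Lf).trans hμ
  set q := Real.exp (-b) * (1 + N * Lf * δ) with hq_def
  have hq1 : q < 1 := by
    rw [hq_def, Real.exp_neg, inv_mul_lt_one₀ (Real.exp_pos _),
      ← Real.log_lt_iff_lt_exp (by linarith)]
    exact hb1
  have hq0 : 0 ≤ q := by positivity
  set r := N * Lf / (lam - μ) with hr_def
  have hr1 : r < 1 := (div_lt_one hlμ).2 hμ
  have hr0 : 0 ≤ r := by positivity
  obtain ⟨G, hG⟩ := exists_weight_bound hθ hneg hpos hω hp hshift hb.le hμ0.le hμψ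
  let W : ℤ → ℝ → ℝ := fun k t => Real.exp (μ * clock θ k t - b * k)
  have hW0 : ∀ k t, 0 < W k t := fun k t => Real.exp_pos _
  have hWG : ∀ k, ∀ t ∈ Icc (θ (2 * k - 1)) (θ (2 * k)), W k t ≤ Real.exp G := fun k t ht =>
    Real.exp_le_exp.2 (abs_le.1 (hG k t ht)).2
  have hGW : ∀ k, ∀ t ∈ Icc (θ (2 * k - 1)) (θ (2 * k)), Real.exp (-G) ≤ W k t := fun k t ht =>
    Real.exp_le_exp.2 (abs_le.1 (hG k t ht)).1
  refine ⟨fun k t x => W k t * adaptedNorm θ A lam k t x, Real.exp (-G), Real.exp G * N, max q r,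
    N * δ * Real.exp G + N / (lam - μ) * Real.exp G, Real.exp_pos _, by positivity,
    le_max_of_le_left hq0, max_lt hq1 hr1, by positivity, ?_, ?_, ?_⟩
  · intro k t ht x
    exact mul_le_mul (hGW k t ht) (hA.norm_le_adaptedNorm ht x) (norm_nonneg _) (hW0 k t).le
  · intro k t ht x
    rw [mul_assoc]
    exact mul_le_mul (hWG k t ht) (hA.adaptedNorm_le_mul_norm ht x)
      ((norm_nonneg _).trans (hA.norm_le_adaptedNorm ht x)) (Real.exp_pos _).le
  · intro k x₀ h₀ x h D ε hD hε hh hx₀ hx hh₀ hhx t ht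
    have hα : θ (2 * (k + 1) - 1) = θ (2 * k + 1) := congrArg θ (by ring)
    set a := θ (2 * (k + 1) - 1) with ha_def
    have hat : a ≤ t := ht.1
    have hβk : θ (2 * k) ∈ Icc (θ (2 * k - 1)) (θ (2 * k)) :=
      right_mem_Icc.2 (left_lt_right hθ k).le
    have ha : a ∈ Icc a (θ (2 * (k + 1))) := left_mem_Icc.2 (ht.1.trans ht.2)
    have hWa : W (k + 1) a = Real.exp (-b) * W k (θ (2 * k)) := by
      simp only [W]
      rw [← Real.exp_add, hα, clock_left_add_one hθ hneg hpos, clock_right]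
      congr 1
      push_cast
      ring
    have hWt : ∀ u, W (k + 1) u = W (k + 1) a * Real.exp (μ * (u - a)) := fun u => by
      simp only [W]
      rw [← Real.exp_add, ← clock_sub_clock (θ := θ) (k + 1) u a]
      congr 1
      ring
    set w := x₀ + gapLength θ k • (A x₀ + h₀) with hw
    have hwle : W (k + 1) a * adaptedNorm θ A lam (k + 1) a w ≤ q * D + N * δ * Real.exp G * ε := by
      have e1 : adaptedNorm θ A lam (k + 1) a w
          ≤ adaptedNorm θ A lam k (θ (2 * k)) x₀
            + N * (δ * (Lf * adaptedNorm θ A lam k (θ (2 * k)) x₀ + ε)) := by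
        have : w = (x₀ + gapLength θ k • A x₀) + gapLength θ k • h₀ := by
          rw [hw, smul_add, add_assoc]
        rw [this]
        refine (hA.adaptedNorm_add_le ha _ _).trans (add_le_add
          (hα ▸ hA.adaptedNorm_jump_le hθ hneg hpos k x₀)
          ((hA.adaptedNorm_le_mul_norm ha _).trans ?_))
        rw [norm_smul, Real.norm_of_nonneg (gapLength_pos hθ k).le]
        gcongr
        · exact hδ k
        · refine hh₀.trans ?_
          gcongr
          exact hA.norm_le_adaptedNorm hβk x₀
      calc _ ≤ W (k + 1) a * (adaptedNorm θ A lam k (θ (2 * k)) x₀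
              + N * (δ * (Lf * adaptedNorm θ A lam k (θ (2 * k)) x₀ + ε))) :=
            mul_le_mul_of_nonneg_left e1 (hW0 _ _).le
        _ = q * (W k (θ (2 * k)) * adaptedNorm θ A lam k (θ (2 * k)) x₀)
              + N * δ * W (k + 1) a * ε := by
            rw [hWa, hq_def]; ring
        _ ≤ q * D + N * δ * Real.exp G * ε := by
            gcongr
            exact hWG _ _ ha
    -- The weight grows like `e^{μ (v - a)}` along the interval, so a uniform weighted bound on `x`
    -- is an unweighted bound on `h` decaying at rate `μ`.
    set M := (Lf * D + Real.exp G * ε) / W (k + 1) a with hM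
    have hhM : ∀ v ∈ Icc a t, ‖h v‖ ≤ M * Real.exp (-μ * (v - a)) := by
      intro v hv
      have hv' : v ∈ Icc a (θ (2 * (k + 1))) := ⟨hv.1, hv.2.trans ht.2⟩
      have e1 : M * Real.exp (-μ * (v - a)) = (Lf * D + Real.exp G * ε) / W (k + 1) v := by
        rw [hM, hWt v, neg_mul, Real.exp_neg]
        field_simp
      rw [e1, le_div_iff₀ (hW0 _ _)]
      calc ‖h v‖ * W (k + 1) v ≤ (Lf * adaptedNorm θ A lam (k + 1) v (x v) + ε) * W (k + 1) v := by
            refine mul_le_mul_of_nonneg_right ((hhx v hv').trans ?_) (hW0 _ _).le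
            gcongr
            exact hA.norm_le_adaptedNorm hv' _
        _ = Lf * (W (k + 1) v * adaptedNorm θ A lam (k + 1) v (x v)) + W (k + 1) v * ε := by ring
        _ ≤ Lf * D + Real.exp G * ε := by
            gcongr
            · exact hx v hv'
            · exact hWG _ _ hv'
    have key := hA.adaptedNorm_duhamel_le hN.le (μ := μ) (M := M) (by linarith) ht w
      (hh.mono_set (by
        rw [uIcc_of_le hat, uIcc_of_le (hat.trans ht.2)]; exact Icc_subset_Icc_right ht.2)) hhM
    rw [← ha_def] at key
    -- In the weighted norm the estimate is a convex combination, with coefficients `γ` and `1 - γ`,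
    -- of the bound after the jump (factor `q`) and the bound from the integral (factor `r`). Hence
    -- `max q r` works for every `t`, however short the elapsed time.
    set γ := Real.exp (-(lam - μ) * (t - a)) with hγ
    have hγ0 : 0 ≤ γ := (Real.exp_pos _).le
    have hγ1 : γ ≤ 1 := Real.exp_le_one_iff.2 (by nlinarith [sub_nonneg.2 hat])
    have e3 : Real.exp (μ * (t - a)) * Real.exp (-lam * (t - a)) = γ := by
      rw [← Real.exp_add, hγ]; congr 1; ring
    have e4 : Real.exp (μ * (t - a)) * Real.exp (-μ * (t - a)) = 1 := by
      rw [← Real.exp_add, neg_mul, add_neg_cancel, Real.exp_zero]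
    have e5 : W (k + 1) a * M = Lf * D + Real.exp G * ε := by
      rw [hM]; exact mul_div_cancel₀ _ (hW0 _ _).ne'
    have hr : r * D ≤ max q r * D := mul_le_mul_of_nonneg_right (le_max_right _ _) hD
    have hq : q * D ≤ max q r * D := mul_le_mul_of_nonneg_right (le_max_left _ _) hD
    have hA0 : 0 ≤ N * δ * Real.exp G * ε := by positivity
    have hB0 : 0 ≤ N / (lam - μ) * Real.exp G * ε := by positivity
    calc _ ≤ W (k + 1) t * (Real.exp (-lam * (t - a)) * adaptedNorm θ A lam (k + 1) a w
        + N * M * ((Real.exp (-μ * (t - a)) - Real.exp (-lam * (t - a))) / (lam - μ))) :=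
          mul_le_mul_of_nonneg_left key (hW0 _ _).le
      _ = (Real.exp (μ * (t - a)) * Real.exp (-lam * (t - a))) *
            (W (k + 1) a * adaptedNorm θ A lam (k + 1) a w)
          + N * (W (k + 1) a * M) * (Real.exp (μ * (t - a)) * Real.exp (-μ * (t - a))
            - Real.exp (μ * (t - a)) * Real.exp (-lam * (t - a))) / (lam - μ) := by
          rw [hWt t]; ring
      _ = γ * (W (k + 1) a * adaptedNorm θ A lam (k + 1) a w)
          + (1 - γ) * (r * D + N / (lam - μ) * Real.exp G * ε) := by
          rw [e3, e4, e5, hr_def]; ring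
      _ ≤ γ * (max q r * D + N * δ * Real.exp G * ε)
          + (1 - γ) * (max q r * D + N / (lam - μ) * Real.exp G * ε) := by
          have : 0 ≤ 1 - γ := by linarith
          gcongr
          exact hwle.trans (by gcongr)
      _ ≤ max q r * D + (N * δ * Real.exp G + N / (lam - μ) * Real.exp G) * ε := by
          rw [← sub_nonneg]
          refine (add_nonneg (mul_nonneg (sub_nonneg.2 hγ1) hA0) (mul_nonneg hγ0 hB0)).trans_eq ?_
          ring

end StepContraction

/-! ### The Picard operator and its unique bounded fixed point. -/

section Picard

variable {θ : ℤ → ℝ} {E : Type*} [NormedAddCommGroup E]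

/-- The inhomogeneity along `x` on the `k`-th interval of the time scale. -/
def inhomogeneity (hθ : StrictMono θ) (f : timeScale θ → E → E) (c : ℤ → E) (k : ℤ) (x : ℝ → E)
    (t : ℝ) : E := f (clampPt hθ k t) (x t) + c k

theorem continuousAt_inhomogeneity (hθ : StrictMono θ) {f : timeScale θ → E → E}
    (hf : RdContinuous f) (c : ℤ → E) {k : ℤ} {x : ℝ → E} {t : ℝ} (hx : ContinuousAt x t)
    (ht : t < θ (2 * k)) : ContinuousAt (inhomogeneity hθ f c k x) t := by
  have hmem : (clampPt hθ k t : ℝ) ∈ Ico (θ (2 * k - 1)) (θ (2 * k)) := by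
    refine ⟨(clampPt_mem hθ k t).1, ?_⟩
    simp only [clampPt, coe_inclusion, coe_projIcc, max_lt_iff]
    exact ⟨left_lt_right hθ k, min_lt_of_right_lt ht⟩
  have h1 := (hf (clampPt hθ k t) (x t)).1 (forwardJump_of_lt hmem)
  have h2 : ContinuousAt (fun u => (clampPt hθ k u, x u)) t :=
    (continuous_clampPt hθ k).continuousAt.prodMk hx
  have h3 : ContinuousAt (fun u => f (clampPt hθ k u) (x u)) t :=
    ContinuousAt.comp (f := fun u => (clampPt hθ k u, x u))
      (g := fun q : timeScale θ × E => f q.1 q.2) h1 h2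
  exact h3.add continuousAt_const

/-- At the right end the value of `f` need not agree with its left limit, so continuity is available
only inside the interval. Together with boundedness this suffices. -/
theorem intervalIntegrable_inhomogeneity (hθ : StrictMono θ) {f : timeScale θ → E → E}
    (hf : RdContinuous f) {Mf : ℝ} (hMf : ∀ t x, ‖f t x‖ ≤ Mf) (c : ℤ → E) (k : ℤ) {x : ℝ → E}
    (hx : Continuous x) :
    IntervalIntegrable (inhomogeneity hθ f c k x) MeasureTheory.volume
      (θ (2 * k - 1)) (θ (2 * k)) := by
  rw [intervalIntegrable_iff_integrableOn_Ioo_of_le (left_lt_right hθ k).le]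
  refine MeasureTheory.IntegrableOn.of_bound (by simp) ?_ (Mf + ‖c k‖)
    (Eventually.of_forall fun t => (norm_add_le _ _).trans (add_le_add_left (hMf _ _) _))
  exact ContinuousOn.aestronglyMeasurable (fun t ht =>
    (continuousAt_inhomogeneity hθ hf c hx.continuousAt ht.2).continuousWithinAt)
    measurableSet_Ioo

variable [NormedSpace ℝ E]

/-- The Picard operator: on each interval of the time scale, solve the linear equation with the
inhomogeneity, and the value at the left end, that are given by the previous iterate. -/
def picard (hθ : StrictMono θ) (A : E →L[ℝ] E) (f : timeScale θ → E → E) (c : ℤ → E)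
    (y : ℤ → ℝ → E) (k : ℤ) (t : ℝ) : E :=
  duhamel A (θ (2 * k - 1))
    (y (k - 1) (θ (2 * (k - 1))) + gapLength θ (k - 1) • (A (y (k - 1) (θ (2 * (k - 1))))
      + inhomogeneity hθ f c (k - 1) (y (k - 1)) (θ (2 * (k - 1)))))
    (inhomogeneity hθ f c k (y k)) (clampPt hθ k t)

variable {A : E →L[ℝ] E} {f : timeScale θ → E → E} {Mf Lf : ℝ} {ν : ℤ → ℝ → E → ℝ}
  {c₁ c₂ κ C : ℝ}

theorem picard_clampPt (hθ : StrictMono θ) (c : ℤ → E) (y : ℤ → ℝ → E) (k : ℤ) (t : ℝ) :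
    picard hθ A f c y k (clampPt hθ k t) = picard hθ A f c y k t := by
  rw [picard, picard, clampPt_clampPt]

theorem StepContraction.picard_le (hν : StepContraction θ A Lf ν c₁ c₂ κ C) (hθ : StrictMono θ)
    (hf : RdContinuous f) (hMf : ∀ t x, ‖f t x‖ ≤ Mf) (hLf : 0 ≤ Lf) (c : ℤ → E)
    {y : ℤ → ℝ → E} (hy : ∀ k, Continuous (y k)) {Mc B : ℝ} (hc : ∀ k, ‖c k‖ ≤ Mc)
    (hB : ∀ k t, ‖y k t‖ ≤ B) (k : ℤ) (t : ℝ) :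
    ‖picard hθ A f c y k t‖ ≤ (κ * (c₂ * B) + C * (Mf + Mc)) / c₁ := by
  obtain ⟨k, rfl⟩ : ∃ j, k = j + 1 := ⟨k - 1, by ring⟩
  have hB0 : 0 ≤ B := (norm_nonneg _).trans (hB 0 0)
  have hM0 : 0 ≤ Mf + Mc := (norm_nonneg _).trans
    ((norm_add_le _ _).trans (add_le_add (hMf (clampPt hθ 0 0) 0) (hc 0)))
  have hin : ∀ k u, ‖inhomogeneity hθ f c k (y k) u‖ ≤ Lf * ‖y k u‖ + (Mf + Mc) := fun k u =>
    ((norm_add_le _ _).trans (add_le_add (hMf _ _) (hc k))).trans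
      (le_add_of_nonneg_left (by positivity))
  have hup : ∀ k, ∀ u ∈ Icc (θ (2 * k - 1)) (θ (2 * k)), ν k u (y k u) ≤ c₂ * B := fun k u hu =>
    (hν.upper k u hu _).trans (mul_le_mul_of_nonneg_left (hB k u) hν.c₂_nonneg)
  rw [le_div_iff₀' hν.c₁_pos]
  refine (hν.lower _ _ (clampPt_mem hθ (k + 1) t) _).trans ?_
  rw [picard, add_sub_cancel_right]
  -- The whole inhomogeneity is treated as an error of size `ε = Mf + Mc`.
  exact hν.step k _ _ (y (k + 1)) _ _ _ (mul_nonneg hν.c₂_nonneg hB0) hM0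
    (intervalIntegrable_inhomogeneity hθ hf hMf c (k + 1) (hy (k + 1)))
    (hup k _ (right_mem_Icc.2 (left_lt_right hθ k).le)) (hup (k + 1)) (hin k _)
    (fun u _ => hin (k + 1) u) _ (clampPt_mem hθ (k + 1) t)

variable [CompleteSpace E]

theorem hasDerivAt_flow (A : E →L[ℝ] E) (t : ℝ) : HasDerivAt (flow A) (A * flow A t) t :=
  hasDerivAt_exp_smul_const' A t

theorem hasDerivAt_flow' (A : E →L[ℝ] E) (t : ℝ) : HasDerivAt (flow A) (flow A t * A) t :=
  hasDerivAt_exp_smul_const A t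

/-- This form frees the integrand of `t`, so that continuity and the derivative follow from those of
a primitive and the product rule. -/
theorem duhamel_eq (A : E →L[ℝ] E) {a t : ℝ} (w : E) {h : ℝ → E}
    (hh : IntervalIntegrable h MeasureTheory.volume a t) :
    duhamel A a w h t = flow A (t - a) (w + ∫ v in a..t, flow A (a - v) (h v)) := by
  have hc : Continuous fun v => flow A (a - v) := (continuous_flow A).comp (by fun_prop)
  rw [duhamel, map_add, ← ContinuousLinearMap.intervalIntegral_comp_comm _
    (hh.continuous_clm_apply hc)]
  congr 2
  ext v
  rw [show t - v = (t - a) + (a - v) by ring, flow_add]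
  rfl

theorem continuousOn_duhamel (A : E →L[ℝ] E) {a b : ℝ} (hab : a ≤ b) (w : E) {h : ℝ → E}
    (hh : IntervalIntegrable h MeasureTheory.volume a b) :
    ContinuousOn (duhamel A a w h) (Icc a b) := by
  have hc : Continuous fun v => flow A (a - v) := (continuous_flow A).comp (by fun_prop)
  have h1 := intervalIntegral.continuousOn_primitive_interval' (hh.continuous_clm_apply hc)
    left_mem_uIcc
  rw [uIcc_of_le hab] at h1
  have h2 : ContinuousOn (fun t => flow A (t - a) (w + ∫ v in a..t, flow A (a - v) (h v)))
      (Icc a b) :=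
    ((continuous_flow A).comp (continuous_id.sub continuous_const)).continuousOn.clm_apply
      (continuousOn_const.add h1)
  refine h2.congr fun t ht => duhamel_eq A w (hh.mono_set ?_)
  rw [uIcc_of_le hab, uIcc_of_le ht.1]
  exact Icc_subset_Icc_right ht.2

theorem hasDerivWithinAt_duhamel (A : E →L[ℝ] E) {a b t : ℝ} (w : E) {h : ℝ → E}
    (hh : IntervalIntegrable h MeasureTheory.volume a b) (hc : ∀ u < b, ContinuousAt h u)
    (ht : t ∈ Ico a b) :
    HasDerivWithinAt (duhamel A a w h) (A (duhamel A a w h t) + h t) (Icc a b) t := by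
  have hsub : ∀ u ∈ Icc a b, IntervalIntegrable h MeasureTheory.volume a u := fun u hu =>
    hh.mono_set (by
      rw [uIcc_of_le hu.1, uIcc_of_le (hu.1.trans hu.2)]; exact Icc_subset_Icc_right hu.2)
  have hφ : Continuous fun v => flow A (a - v) := (continuous_flow A).comp (by fun_prop)
  have hcont : ∀ u ∈ Iio b, ContinuousAt (fun v => flow A (a - v) (h v)) u := fun u hu =>
    hφ.continuousAt.clm_apply (hc u hu)
  have htI := Ico_subset_Icc_self ht
  have h1 : HasDerivAt (fun u => ∫ v in a..u, flow A (a - v) (h v)) (flow A (a - t) (h t)) t :=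
    intervalIntegral.integral_hasDerivAt_right ((hsub t htI).continuous_clm_apply hφ)
      (ContinuousAt.stronglyMeasurableAtFilter isOpen_Iio hcont t ht.2) (hcont t ht.2)
  have h2 : HasDerivAt (fun u => flow A (u - a)) (A * flow A (t - a)) t := by
    exact (hasDerivAt_flow A (t - a)).comp_sub_const t a
  have h3 := h2.clm_apply (h1.const_add w)
  refine (h3.hasDerivWithinAt.congr (fun u hu => duhamel_eq A w (hsub u hu))
    (duhamel_eq A w (hsub t htI))).congr_deriv ?_
  rw [duhamel_eq A w (hsub t htI)]
  congr 1
  change (flow A (t - a) * flow A (a - t)) (h t) = h t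
  rw [← flow_add, show t - a + (a - t) = 0 by ring, flow_zero]
  rfl

theorem eq_duhamel_of_hasDerivWithinAt (A : E →L[ℝ] E) {a b : ℝ} {y h : ℝ → E}
    (hh : IntervalIntegrable h MeasureTheory.volume a b) (hy : ContinuousOn y (Icc a b))
    (hd : ∀ t ∈ Ico a b, HasDerivWithinAt y (A (y t) + h t) (Icc a b) t) {t : ℝ}
    (ht : t ∈ Icc a b) : y t = duhamel A a (y a) h t := by
  have hsub : IntervalIntegrable h MeasureTheory.volume a t :=
    hh.mono_set (by
      rw [uIcc_of_le ht.1, uIcc_of_le (ht.1.trans ht.2)]; exact Icc_subset_Icc_right ht.2)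
  have hφ : Continuous fun v => flow A (t - v) := (continuous_flow A).comp (by fun_prop)
  -- In `v`, the derivative of `flow A (t - v) (y v)` is `flow A (t - v) (h v)`: the terms with `A`
  -- cancel.
  have key := intervalIntegral.integral_eq_sub_of_hasDeriv_right_of_le ht.1
    (f := fun v => flow A (t - v) (y v)) (f' := fun v => flow A (t - v) (h v))
    (hφ.continuousOn.clm_apply (hy.mono (Icc_subset_Icc_right ht.2))) (fun v hv => ?_)
    (hsub.continuous_clm_apply hφ)
  · rw [duhamel, key, sub_self, flow_zero]
    simp
  · have hvb : v < b := hv.2.trans_le ht.2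
    have h1 : HasDerivAt y (A (y v) + h v) v :=
      (hd v ⟨hv.1.le, hvb⟩).hasDerivAt (Icc_mem_nhds hv.1 hvb)
    have h2 : HasDerivAt (fun u => flow A (t - u)) (-(flow A (t - v) * A)) v := by
      exact (hasDerivAt_flow' A (t - v)).comp_const_sub t v
    refine ((h2.clm_apply h1).congr_deriv ?_).hasDerivWithinAt
    rw [map_add]
    simp

theorem continuous_picard (hθ : StrictMono θ) (hf : RdContinuous f) (hMf : ∀ t x, ‖f t x‖ ≤ Mf)
    (c : ℤ → E) {y : ℤ → ℝ → E} (hy : ∀ k, Continuous (y k)) (k : ℤ) :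
    Continuous (picard hθ A f c y k) :=
  (continuousOn_duhamel A (left_lt_right hθ k).le _
    (intervalIntegrable_inhomogeneity hθ hf hMf c k (hy k))).comp_continuous
    (continuous_subtype_val.comp (continuous_clampPt hθ k)) (clampPt_mem hθ k)

theorem StepContraction.picard_sub_le (hν : StepContraction θ A Lf ν c₁ c₂ κ C)
    (hθ : StrictMono θ) (hf : RdContinuous f) (hMf : ∀ t x, ‖f t x‖ ≤ Mf)
    (hlip : ∀ t x₁ x₂, ‖f t x₁ - f t x₂‖ ≤ Lf * ‖x₁ - x₂‖) (c c' : ℤ → E)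
    {y y' : ℤ → ℝ → E} (hy : ∀ k, Continuous (y k)) (hy' : ∀ k, Continuous (y' k)) {D ε : ℝ}
    (hD : 0 ≤ D) (hε : 0 ≤ ε) {k : ℤ} (hc : ‖c k - c' k‖ ≤ ε)
    (hc' : ‖c (k + 1) - c' (k + 1)‖ ≤ ε)
    (hDk : ν k (θ (2 * k)) (y k (θ (2 * k)) - y' k (θ (2 * k))) ≤ D)
    (hDk' : ∀ u ∈ Icc (θ (2 * (k + 1) - 1)) (θ (2 * (k + 1))),
      ν (k + 1) u (y (k + 1) u - y' (k + 1) u) ≤ D) {t : ℝ}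
    (ht : t ∈ Icc (θ (2 * (k + 1) - 1)) (θ (2 * (k + 1)))) :
    ν (k + 1) t (picard hθ A f c y (k + 1) t - picard hθ A f c' y' (k + 1) t)
      ≤ κ * D + C * ε := by
  have hin : ∀ k u, ‖c k - c' k‖ ≤ ε →
      ‖inhomogeneity hθ f c k (y k) u - inhomogeneity hθ f c' k (y' k) u‖
        ≤ Lf * ‖y k u - y' k u‖ + ε := fun k u h => by
    rw [inhomogeneity, inhomogeneity, add_sub_add_comm]
    exact (norm_add_le _ _).trans (add_le_add (hlip _ _ _) h)
  have hi := intervalIntegrable_inhomogeneity hθ hf hMf c (k + 1) (hy (k + 1))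
  have hi' := intervalIntegrable_inhomogeneity hθ hf hMf c' (k + 1) (hy' (k + 1))
  have hsub : uIcc (θ (2 * (k + 1) - 1)) t ⊆ uIcc (θ (2 * (k + 1) - 1)) (θ (2 * (k + 1))) := by
    rw [uIcc_of_le ht.1, uIcc_of_le (ht.1.trans ht.2)]
    exact Icc_subset_Icc_right ht.2
  have key := hν.step k (y k (θ (2 * k)) - y' k (θ (2 * k)))
    (inhomogeneity hθ f c k (y k) (θ (2 * k)) - inhomogeneity hθ f c' k (y' k) (θ (2 * k)))
    (fun u => y (k + 1) u - y' (k + 1) u)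
    (fun u => inhomogeneity hθ f c (k + 1) (y (k + 1)) u
      - inhomogeneity hθ f c' (k + 1) (y' (k + 1)) u) D ε hD hε (hi.sub hi') hDk hDk'
    (hin k _ hc) (fun u _ => hin (k + 1) u hc') t ht
  rw [picard, picard, coe_clampPt_of_mem hθ ht, add_sub_cancel_right,
    duhamel_sub A _ _ (hi.mono_set hsub) (hi'.mono_set hsub)]
  refine le_of_eq_of_le ?_ key
  congr 2
  rw [map_sub]
  module

theorem StepContraction.iterate_picard_sub_le (hν : StepContraction θ A Lf ν c₁ c₂ κ C)
    (hθ : StrictMono θ) (hf : RdContinuous f) (hMf : ∀ t x, ‖f t x‖ ≤ Mf)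
    (hlip : ∀ t x₁ x₂, ‖f t x₁ - f t x₂‖ ≤ Lf * ‖x₁ - x₂‖) (c : ℤ → E)
    {y y' : ℤ → ℝ → E} (hy : ∀ k, Continuous (y k)) (hy' : ∀ k, Continuous (y' k)) {B : ℝ}
    (hB : ∀ k t, ‖y k t - y' k t‖ ≤ B) (n : ℕ) (k : ℤ) {t : ℝ}
    (ht : t ∈ Icc (θ (2 * k - 1)) (θ (2 * k))) :
    c₁ * ‖(picard hθ A f c)^[n] y k t - (picard hθ A f c)^[n] y' k t‖ ≤ κ ^ n * (c₂ * B) := by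
  have hB0 : 0 ≤ B := (norm_nonneg _).trans (hB 0 0)
  have hcont : ∀ {y : ℤ → ℝ → E}, (∀ k, Continuous (y k)) → ∀ n k,
      Continuous ((picard hθ A f c)^[n] y k) := fun {y} hy n => by
    induction n with
    | zero => exact hy
    | succ n ih =>
      rw [Function.iterate_succ_apply']
      exact continuous_picard hθ hf hMf c ih
  suffices h : ∀ n k, ∀ t ∈ Icc (θ (2 * k - 1)) (θ (2 * k)),
      ν k t ((picard hθ A f c)^[n] y k t - (picard hθ A f c)^[n] y' k t) ≤ κ ^ n * (c₂ * B) from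
    (hν.lower k t ht _).trans (h n k t ht)
  intro n
  induction n with
  | zero =>
    intro k t ht
    rw [pow_zero, one_mul]
    exact (hν.upper k t ht _).trans (mul_le_mul_of_nonneg_left (hB k t) hν.c₂_nonneg)
  | succ n ih =>
    intro k t ht
    obtain ⟨k, rfl⟩ : ∃ j, k = j + 1 := ⟨k - 1, by ring⟩
    rw [Function.iterate_succ_apply', Function.iterate_succ_apply']
    have := hν.picard_sub_le hθ hf hMf hlip c c (hcont hy n) (hcont hy' n) (ε := 0)
      (mul_nonneg (pow_nonneg hν.κ_nonneg n) (mul_nonneg hν.c₂_nonneg hB0)) le_rfl (by simp)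
      (by simp) (ih k _ (right_mem_Icc.2 (left_lt_right hθ k).le)) (ih (k + 1)) ht
    rw [mul_zero, add_zero, ← mul_assoc, ← pow_succ'] at this
    exact this

theorem StepContraction.eq_of_picard_eq (hν : StepContraction θ A Lf ν c₁ c₂ κ C)
    (hθ : StrictMono θ) (hf : RdContinuous f) (hMf : ∀ t x, ‖f t x‖ ≤ Mf)
    (hlip : ∀ t x₁ x₂, ‖f t x₁ - f t x₂‖ ≤ Lf * ‖x₁ - x₂‖) {c : ℤ → E}
    {y y' : ℤ → ℝ → E} (hy : ∀ k, Continuous (y k)) (hy' : ∀ k, Continuous (y' k)) {B : ℝ}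
    (hB : ∀ k t, ‖y k t - y' k t‖ ≤ B) (h : picard hθ A f c y = y)
    (h' : picard hθ A f c y' = y') {k : ℤ} {t : ℝ}
    (ht : t ∈ Icc (θ (2 * k - 1)) (θ (2 * k))) : y k t = y' k t := by
  have h1 : ∀ n : ℕ, c₁ * ‖y k t - y' k t‖ ≤ κ ^ n * (c₂ * B) := fun n => by
    have := hν.iterate_picard_sub_le hθ hf hMf hlip c hy hy' hB n k ht
    rwa [Function.iterate_fixed h, Function.iterate_fixed h'] at this
  have h2 : Tendsto (fun n : ℕ => κ ^ n * (c₂ * B)) atTop (𝓝 (0 * (c₂ * B))) :=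
    (tendsto_pow_atTop_nhds_zero_of_lt_one hν.κ_nonneg hν.κ_lt_one).mul_const _
  rw [zero_mul] at h2
  have h3 := ge_of_tendsto' h2 h1
  have h4 : ‖y k t - y' k t‖ ≤ 0 := nonpos_of_mul_nonpos_right h3 hν.c₁_pos
  exact sub_eq_zero.1 (norm_le_zero_iff.1 h4)

theorem StepContraction.exists_picard_eq (hν : StepContraction θ A Lf ν c₁ c₂ κ C)
    (hθ : StrictMono θ) (hf : RdContinuous f) (hMf : ∀ t x, ‖f t x‖ ≤ Mf) (hLf : 0 ≤ Lf)
    (hlip : ∀ t x₁ x₂, ‖f t x₁ - f t x₂‖ ≤ Lf * ‖x₁ - x₂‖) {c : ℤ → E} {Mc : ℝ}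
    (hc : ∀ k, ‖c k‖ ≤ Mc) :
    ∃ y : ℤ → ℝ → E, (∀ k, Continuous (y k)) ∧ (∃ B, ∀ k t, ‖y k t‖ ≤ B) ∧
      picard hθ A f c y = y := by
  have hcurry : ∀ y : BoundedContinuousFunction (ℤ × ℝ) E, ∀ k, Continuous fun t => y (k, t) :=
    fun y k => y.continuous.comp (by fun_prop)
  let P : BoundedContinuousFunction (ℤ × ℝ) E → BoundedContinuousFunction (ℤ × ℝ) E := fun y =>
    BoundedContinuousFunction.ofNormedAddCommGroup
      (fun q => picard hθ A f c (fun k t => y (k, t)) q.1 q.2)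
      (continuous_prod_of_discrete_left.2 fun k => continuous_picard hθ hf hMf c (hcurry y) k)
      ((κ * (c₂ * ‖y‖) + C * (Mf + Mc)) / c₁)
      (fun q => hν.picard_le hθ hf hMf hLf c (hcurry y) hc (fun k t => y.norm_coe_le_norm _) _ _)
  have hP : ∀ n y, (fun k t => (P^[n] y) (k, t))
      = (picard hθ A f c)^[n] (fun k t => y (k, t)) := fun n y => by
    induction n with
    | zero => rfl
    | succ n ih =>
      rw [Function.iterate_succ_apply', Function.iterate_succ_apply', ← ih]
      rfl
  obtain ⟨n, hn⟩ : ∃ n : ℕ, κ ^ n * c₂ / c₁ < 1 := by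
    have h2 : Tendsto (fun n : ℕ => κ ^ n * c₂ / c₁) atTop (𝓝 (0 * c₂ / c₁)) :=
      ((tendsto_pow_atTop_nhds_zero_of_lt_one hν.κ_nonneg hν.κ_lt_one).mul_const _).div_const _
    rw [zero_mul, zero_div] at h2
    exact (h2.eventually_lt_const one_pos).exists
  -- The norms are only equivalent to the Euclidean one, so a high iterate is needed to absorb `c₂ /
  -- c₁`. The exponent is `n + 1` to guarantee at least one application of the operator, after which
  -- values outside the interval are those at the clamped point.
  have hn' : κ ^ (n + 1) * c₂ / c₁ < 1 := by
    refine lt_of_le_of_lt ?_ hn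
    have := hν.c₁_pos
    have := hν.c₂_nonneg
    gcongr ?_ * _ / _
    exact pow_le_pow_of_le_one hν.κ_nonneg hν.κ_lt_one.le (Nat.le_succ n)
  have hK0 : 0 ≤ κ ^ (n + 1) * c₂ / c₁ :=
    div_nonneg (mul_nonneg (pow_nonneg hν.κ_nonneg _) hν.c₂_nonneg) hν.c₁_pos.le
  have hcontr : ContractingWith (κ ^ (n + 1) * c₂ / c₁).toNNReal (P^[n + 1]) := by
    refine ⟨by rwa [Real.toNNReal_lt_one], LipschitzWith.of_dist_le_mul fun y y' => ?_⟩
    rw [Real.coe_toNNReal _ hK0, BoundedContinuousFunction.dist_le (mul_nonneg hK0 dist_nonneg)]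
    rintro ⟨k, t⟩
    have h1 : ∀ y, (P^[n + 1] y) (k, t) = (P^[n + 1] y) (k, (clampPt hθ k t : ℝ)) := fun y => by
      rw [Function.iterate_succ_apply']
      exact (picard_clampPt hθ c (fun k t => (P^[n] y) (k, t)) k t).symm
    have h2 := hν.iterate_picard_sub_le hθ hf hMf hlip c (hcurry y) (hcurry y')
      (B := dist y y') (fun k t => by
        rw [← dist_eq_norm]; exact BoundedContinuousFunction.dist_coe_le_dist _) (n + 1) k
      (clampPt_mem hθ k t)
    rw [← hP, ← hP] at h2
    rw [h1, h1, dist_eq_norm, div_mul_eq_mul_div, le_div_iff₀' hν.c₁_pos, mul_assoc]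
    exact h2
  have hfix := hcontr.isFixedPt_fixedPoint_iterate
  refine ⟨fun k t => ContractingWith.fixedPoint (P^[n + 1]) hcontr (k, t), hcurry _,
    ⟨_, fun k t => BoundedContinuousFunction.norm_coe_le_norm _ _⟩, ?_⟩
  have := hP 1 (ContractingWith.fixedPoint (P^[n + 1]) hcontr)
  rw [Function.iterate_one, Function.iterate_one, hfix] at this
  exact this.symm

end Picard

/-! ### Translations that preserve the equation. -/

section EquationShift

variable {θ : ℤ → ℝ} {E : Type*}

/-- A periodicity `τ` of the time scale and of `f` moves the index of the intervals by `q`. -/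
structure EquationShift (θ : ℤ → ℝ) (f : timeScale θ → E → E) (q : ℤ) (τ : ℝ) : Prop where
  add_eq : ∀ k, θ (k + 2 * q) = θ k + τ
  periodic : TimeScalePeriodic (timeScale θ) τ
  apply_eq : ∀ (t : timeScale θ) (h : (t : ℝ) + τ ∈ timeScale θ) (x : E), f ⟨t + τ, h⟩ x = f t x

variable {f : timeScale θ → E → E} {q : ℤ} {τ : ℝ}

theorem EquationShift.right_eq (h : EquationShift θ f q τ) (k : ℤ) :
    θ (2 * (k + q)) = θ (2 * k) + τ := by rw [mul_add, h.add_eq]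

theorem EquationShift.left_eq (h : EquationShift θ f q τ) (k : ℤ) :
    θ (2 * (k + q) - 1) = θ (2 * k - 1) + τ := by
  rw [show 2 * (k + q) - 1 = 2 * k - 1 + 2 * q by ring, h.add_eq]

theorem EquationShift.gapLength_eq (h : EquationShift θ f q τ) (k : ℤ) :
    gapLength θ (k + q) = gapLength θ k := by
  rw [gapLength, gapLength, h.right_eq, show 2 * (k + q) + 1 = 2 * k + 1 + 2 * q by ring, h.add_eq,
    add_sub_add_right_eq_sub]

theorem EquationShift.coe_clampPt (h : EquationShift θ f q τ) (hθ : StrictMono θ) (k : ℤ) (t : ℝ) :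
    (clampPt hθ (k + q) (t + τ) : ℝ) = clampPt hθ k t + τ := by
  simp only [clampPt, coe_inclusion, coe_projIcc, h.right_eq, h.left_eq, min_add_add_right,
    max_add_add_right]

theorem EquationShift.clampPt_eq (h : EquationShift θ f q τ) (hθ : StrictMono θ) (k : ℤ) (t : ℝ) :
    clampPt hθ (k + q) (t + τ)
      = ⟨clampPt hθ k t + τ, (h.periodic _).2 (clampPt hθ k t).2⟩ :=
  Subtype.ext (h.coe_clampPt hθ k t)

theorem EquationShift.apply_clampPt (h : EquationShift θ f q τ) (hθ : StrictMono θ) (k : ℤ)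
    (t : ℝ) (x : E) : f (clampPt hθ (k + q) (t + τ)) x = f (clampPt hθ k t) x := by
  rw [h.clampPt_eq, h.apply_eq]

end EquationShift

/-! ### Solutions of the dynamic equation: existence, periodicity and attraction. -/

section DeltaSolution

variable {θ : ℤ → ℝ} {E : Type*} [NormedAddCommGroup E] [NormedSpace ℝ E]

/-- `y` solves `y^Δ(t) = A y(t) + f(t, y(t)) + cₖ` on the `k`-th interval of the time scale. -/
def DeltaSolution (A : E →L[ℝ] E) (f : timeScale θ → E → E) (c : ℤ → E) (y : timeScale θ → E) :
    Prop :=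
  ∀ (k : ℤ) (t : timeScale θ), (t : ℝ) ∈ Icc (θ (2 * k - 1)) (θ (2 * k)) →
    HasDeltaDerivAt y (A (y t) + f t (y t) + c k) t

variable {A : E →L[ℝ] E} {f : timeScale θ → E → E} {c c' : ℤ → E} {y y' : timeScale θ → E}

theorem DeltaSolution.continuous (h : DeltaSolution A f c y) : Continuous y :=
  continuous_iff_continuousAt.2 fun t => by
    obtain ⟨k, hk⟩ := mem_timeScale.1 t.2
    exact (h k t hk).1

theorem DeltaSolution.continuous_clampPt (h : DeltaSolution A f c y) (hθ : StrictMono θ) (k : ℤ) :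
    Continuous fun t => y (clampPt hθ k t) :=
  h.continuous.comp (_root_.continuous_clampPt hθ k)

theorem DeltaSolution.hasDerivWithinAt (h : DeltaSolution A f c y) (hθ : StrictMono θ) {k : ℤ}
    {t : ℝ} (ht : t ∈ Ico (θ (2 * k - 1)) (θ (2 * k))) :
    HasDerivWithinAt (fun u => y (clampPt hθ k u))
      (A (y (clampPt hθ k t)) + inhomogeneity hθ f c k (fun u => y (clampPt hθ k u)) t)
      (Icc (θ (2 * k - 1)) (θ (2 * k))) t := by
  have hc := coe_clampPt_of_mem hθ (Ico_subset_Icc_self ht)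
  have := HasDeltaDerivAt.hasDerivWithinAt hθ (hc.symm ▸ ht)
    (h k _ (clampPt_mem hθ k t))
  rwa [hc, add_assoc] at this

theorem DeltaSolution.jump (h : DeltaSolution A f c y) (hθ : StrictMono θ) (k : ℤ) :
    y (clampPt hθ (k + 1) (θ (2 * k + 1)))
      = y (clampPt hθ k (θ (2 * k))) + gapLength θ k • (A (y (clampPt hθ k (θ (2 * k))))
        + f (clampPt hθ k (θ (2 * k))) (y (clampPt hθ k (θ (2 * k)))) + c k) :=
  HasDeltaDerivAt.eq_of_right hθ (h k _ (clampPt_mem hθ k _))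

/-- At a right-scattered point the equation is algebraic and can be solved for the forcing. Thus a
solution determines its forcing sequence. -/
theorem DeltaSolution.forcing_eq (h : DeltaSolution A f c y) (hθ : StrictMono θ) (k : ℤ) :
    c k = (gapLength θ k)⁻¹ • (y (clampPt hθ (k + 1) (θ (2 * k + 1)))
        - y (clampPt hθ k (θ (2 * k))))
      - (A (y (clampPt hθ k (θ (2 * k))))
        + f (clampPt hθ k (θ (2 * k))) (y (clampPt hθ k (θ (2 * k))))) := by
  rw [h.jump hθ, add_sub_cancel_left, inv_smul_smul₀ (gapLength_pos hθ k).ne', add_sub_cancel_left]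

theorem duhamel_add_right (A : E →L[ℝ] E) (a τ : ℝ) (w : E) (h : ℝ → E) (t : ℝ) :
    duhamel A (a + τ) w h (t + τ) = duhamel A a w (fun u => h (u + τ)) t := by
  rw [duhamel, duhamel, add_sub_add_right_eq_sub, ← intervalIntegral.integral_comp_add_right]
  simp only [add_sub_add_right_eq_sub]

variable {q : ℤ} {τ : ℝ}

theorem EquationShift.picard_eq (h : EquationShift θ f q τ) (hθ : StrictMono θ)
    (hc : ∀ k, c (k + q) = c k) (y : ℤ → ℝ → E) (k : ℤ) (t : ℝ) :
    picard hθ A f c y (k + q) (t + τ) = picard hθ A f c (fun k t => y (k + q) (t + τ)) k t := by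
  have hin : ∀ k x t, inhomogeneity hθ f c (k + q) x (t + τ)
      = inhomogeneity hθ f c k (fun u => x (u + τ)) t := fun k x t => by
    rw [inhomogeneity, inhomogeneity, h.apply_clampPt, hc]
  rw [picard, h.left_eq, h.coe_clampPt, duhamel_add_right, show k + q - 1 = k - 1 + q by ring,
    h.right_eq, h.gapLength_eq, hin]
  simp only [hin]
  rfl

theorem DeltaSolution.forcing_add_eq (hy : DeltaSolution A f c y) (hθ : StrictMono θ)
    (hs : EquationShift θ f q τ) (h : PeriodicWith y τ) (k : ℤ) : c (k + q) = c k := by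
  have hyp : ∀ k t, y (clampPt hθ (k + q) (t + τ)) = y (clampPt hθ k t) := fun k t => by
    rw [hs.clampPt_eq, h.2]
  rw [hy.forcing_eq hθ, hy.forcing_eq hθ k, hs.gapLength_eq, hs.right_eq,
    show k + q + 1 = k + 1 + q by ring, show 2 * (k + q) + 1 = 2 * k + 1 + 2 * q by ring,
    hs.add_eq, hyp, hyp, hs.apply_clampPt]

variable [CompleteSpace E]

theorem DeltaSolution.picard_eq (h : DeltaSolution A f c y) (hθ : StrictMono θ)
    (hf : RdContinuous f) {Mf : ℝ} (hMf : ∀ t x, ‖f t x‖ ≤ Mf) :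
    picard hθ A f c (fun k t => y (clampPt hθ k t)) = fun k t => y (clampPt hθ k t) := by
  funext k t
  have hmem := clampPt_mem hθ k t
  have key := eq_duhamel_of_hasDerivWithinAt A
    (intervalIntegrable_inhomogeneity hθ hf hMf c k (h.continuous_clampPt hθ k))
    (h.continuous_clampPt hθ k).continuousOn (fun u hu => h.hasDerivWithinAt hθ hu) hmem
  simp only [clampPt_clampPt] at key
  rw [key, picard]
  congr 1
  have := h.jump hθ (k - 1)
  rw [sub_add_cancel, show 2 * (k - 1) + 1 = 2 * k - 1 by ring, add_assoc (A _)] at this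
  exact this.symm

/-- The disjoint intervals allow the pieces of a fixed point to be glued. Before the right end the
equation is the derivative of Duhamel's formula; at the right end it is the fixed-point relation at
the start of the next interval. -/
theorem exists_deltaSolution_of_picard_eq (hθ : StrictMono θ) (hf : RdContinuous f) {Mf : ℝ}
    (hMf : ∀ t x, ‖f t x‖ ≤ Mf) {Y : ℤ → ℝ → E} (hY : ∀ k, Continuous (Y k))
    (h : picard hθ A f c Y = Y) :
    ∃ y : timeScale θ → E, DeltaSolution A f c y ∧ ∀ k t, y (clampPt hθ k t) = Y k t := by
  choose idx hidx using fun t : timeScale θ => mem_timeScale.1 t.2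
  have hclamp : ∀ k t, Y k (clampPt hθ k t) = Y k t := fun k t => by
    rw [← h]
    exact picard_clampPt hθ c Y k t
  have hyY : ∀ k t, Y (idx (clampPt hθ k t)) (clampPt hθ k t) = Y k t := fun k t => by
    rw [index_unique hθ (hidx (clampPt hθ k t)) (clampPt_mem hθ k t), hclamp]
  have hYd : ∀ k, ∀ t ∈ Icc (θ (2 * k - 1)) (θ (2 * k)), Y k t = duhamel A (θ (2 * k - 1))
      (Y (k - 1) (θ (2 * (k - 1))) + gapLength θ (k - 1) • (A (Y (k - 1) (θ (2 * (k - 1))))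
        + inhomogeneity hθ f c (k - 1) (Y (k - 1)) (θ (2 * (k - 1)))))
      (inhomogeneity hθ f c k (Y k)) t := fun k t ht => by
    conv_lhs => rw [← h, picard, coe_clampPt_of_mem hθ ht]
  refine ⟨fun t => Y (idx t) t, fun k t ht => ?_, hyY⟩
  have hYt : Y (idx t) t = Y k t := by rw [index_unique hθ (hidx t) ht]
  have hcont : ContinuousAt (fun t : timeScale θ => Y (idx t) t) t := by
    have h1 : ContinuousAt (fun r : timeScale θ => Y k r) t :=
      ((hY k).comp continuous_subtype_val).continuousAt
    refine h1.congr ?_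
    filter_upwards [eventually_mem_Icc hθ ht] with r hr
    rw [index_unique hθ (hidx r) hr]
  have hfun : (fun u => Y (idx (clampPt hθ k u)) (clampPt hθ k u)) = Y k := funext (hyY k)
  rcases ht.2.lt_or_eq with hlt | heq
  · refine hasDeltaDerivAt_of_lt hθ ⟨ht.1, hlt⟩ hcont ?_
    rw [hfun]
    have hd := hasDerivWithinAt_duhamel A
      (Y (k - 1) (θ (2 * (k - 1))) + gapLength θ (k - 1) • (A (Y (k - 1) (θ (2 * (k - 1))))
        + inhomogeneity hθ f c (k - 1) (Y (k - 1)) (θ (2 * (k - 1)))))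
      (intervalIntegrable_inhomogeneity hθ hf hMf c k (hY k))
      (fun u hu => continuousAt_inhomogeneity hθ hf c (hY k).continuousAt hu) ⟨ht.1, hlt⟩
    refine (hd.congr (hYd k) (hYd k t ht)).congr_deriv ?_
    rw [← hYd k t ht, inhomogeneity, clampPt_coe hθ ht]
    simp only [hYt]
    rw [add_assoc]
  · obtain rfl : t = clampPt hθ k (θ (2 * k)) := by rw [← heq, clampPt_coe hθ ht]
    refine hasDeltaDerivAt_of_right hθ hcont ?_
    simp only [hyY]
    have hα : 2 * (k + 1) - 1 = 2 * k + 1 := by ring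
    have := hYd (k + 1) (θ (2 * k + 1)) (by
      rw [hα]; exact left_mem_Icc.2 (hθ.monotone (by lia)))
    rw [this, hα, duhamel, sub_self, flow_zero, add_sub_cancel_right]
    simp [inhomogeneity, add_assoc]

variable {Mf Lf : ℝ} {ν : ℤ → ℝ → E → ℝ} {c₁ c₂ κ C : ℝ}

theorem StepContraction.exists_deltaSolution (hν : StepContraction θ A Lf ν c₁ c₂ κ C)
    (hθ : StrictMono θ) (hf : RdContinuous f) (hMf : ∀ t x, ‖f t x‖ ≤ Mf) (hLf : 0 ≤ Lf)
    (hlip : ∀ t x₁ x₂, ‖f t x₁ - f t x₂‖ ≤ Lf * ‖x₁ - x₂‖) {Mc : ℝ}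
    (hc : ∀ k, ‖c k‖ ≤ Mc) :
    ∃ y : timeScale θ → E, DeltaSolution A f c y ∧ ∃ B, ∀ t, ‖y t‖ ≤ B := by
  obtain ⟨Y, hY, ⟨B, hB⟩, hfix⟩ := hν.exists_picard_eq hθ hf hMf hLf hlip hc
  obtain ⟨y, hy, hyY⟩ := exists_deltaSolution_of_picard_eq hθ hf hMf hY hfix
  refine ⟨y, hy, B, fun t => ?_⟩
  obtain ⟨k, hk⟩ := mem_timeScale.1 t.2
  rw [← clampPt_coe hθ hk, hyY]
  exact hB _ _

/-- The translated solution is a bounded fixed point of the same Picard operator, so uniqueness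
identifies it with the original. -/
theorem StepContraction.eq_of_deltaSolution_shift (hν : StepContraction θ A Lf ν c₁ c₂ κ C)
    (hθ : StrictMono θ) (hf : RdContinuous f) (hMf : ∀ t x, ‖f t x‖ ≤ Mf)
    (hlip : ∀ t x₁ x₂, ‖f t x₁ - f t x₂‖ ≤ Lf * ‖x₁ - x₂‖) (hs : EquationShift θ f q τ)
    (hc : ∀ k, c (k + q) = c k) (hy : DeltaSolution A f c y) {B : ℝ} (hB : ∀ t, ‖y t‖ ≤ B) :
    PeriodicWith y τ := by
  refine ⟨hs.periodic, fun t h => ?_⟩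
  have hfix := hy.picard_eq hθ hf hMf
  have hfix' : picard hθ A f c (fun k t => y (clampPt hθ (k + q) (t + τ)))
      = fun k t => y (clampPt hθ (k + q) (t + τ)) := by
    funext k t
    rw [← hs.picard_eq hθ hc (fun k t => y (clampPt hθ k t)), hfix]
  obtain ⟨k, hk⟩ := mem_timeScale.1 t.2
  have : y (clampPt hθ (k + q) (t + τ)) = y (clampPt hθ k t) :=
    hν.eq_of_picard_eq hθ hf hMf hlip
    (fun k => (hy.continuous_clampPt hθ (k + q)).comp (continuous_id.add continuous_const))
    (hy.continuous_clampPt hθ) (B := B + B)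
    (fun k t => (norm_sub_le _ _).trans (add_le_add (hB _) (hB _))) hfix' hfix hk
  simp only [hs.clampPt_eq, clampPt_coe hθ hk] at this
  exact this

theorem StepContraction.solution_step (hν : StepContraction θ A Lf ν c₁ c₂ κ C)
    (hθ : StrictMono θ) (hf : RdContinuous f) (hMf : ∀ t x, ‖f t x‖ ≤ Mf)
    (hlip : ∀ t x₁ x₂, ‖f t x₁ - f t x₂‖ ≤ Lf * ‖x₁ - x₂‖) (hy : DeltaSolution A f c y)
    (hy' : DeltaSolution A f c' y') {B : ℝ} (hB : ∀ t, ‖y t - y' t‖ ≤ B) {η a : ℝ} (hη : 0 ≤ η)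
    (ha : 0 ≤ a) {k : ℤ} (hc : ‖c k - c' k‖ ≤ η) (hc' : ‖c (k + 1) - c' (k + 1)‖ ≤ η)
    (hk : ∀ t ∈ Icc (θ (2 * k - 1)) (θ (2 * k)),
      ν k t (y (clampPt hθ k t) - y' (clampPt hθ k t)) ≤ a) :
    ∀ t ∈ Icc (θ (2 * (k + 1) - 1)) (θ (2 * (k + 1))),
      ν (k + 1) t (y (clampPt hθ (k + 1) t) - y' (clampPt hθ (k + 1) t))
        ≤ κ * a + C * η / (1 - κ) := by
  set J := Icc (θ (2 * (k + 1) - 1)) (θ (2 * (k + 1)))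
  set g : ℝ → ℝ := fun t => ν (k + 1) t (y (clampPt hθ (k + 1) t) - y' (clampPt hθ (k + 1) t))
  have hne : (g '' J).Nonempty := (nonempty_Icc.2 (left_lt_right hθ (k + 1)).le).image g
  have hbdd : BddAbove (g '' J) := ⟨c₂ * B, by
    rintro _ ⟨t, ht, rfl⟩
    exact (hν.upper _ t ht _).trans (mul_le_mul_of_nonneg_left (hB _) hν.c₂_nonneg)⟩
  have hg : ∀ t ∈ J, g t ≤ sSup (g '' J) := fun t ht => le_csSup hbdd ⟨t, ht, rfl⟩
  have hκ : 0 < 1 - κ := sub_pos.2 hν.κ_lt_one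
  have hCη : 0 ≤ C * η := mul_nonneg hν.C_nonneg hη
  -- The step estimate involves the difference on the new interval on both sides. If its supremum
  -- exceeds `a`, the inequality is solved for the supremum, which costs the division by `1 - κ`.
  have key : sSup (g '' J) ≤ κ * max a (sSup (g '' J)) + C * η := by
    refine csSup_le hne ?_
    rintro _ ⟨t, ht, rfl⟩
    have := hν.picard_sub_le hθ hf hMf hlip c c' (hy.continuous_clampPt hθ)
      (hy'.continuous_clampPt hθ) (D := max a (sSup (g '' J))) (ha.trans (le_max_left _ _)) hη hc
      hc' ((hk _ (right_mem_Icc.2 (left_lt_right hθ k).le)).trans (le_max_left _ _))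
      (fun u hu => (hg u hu).trans (le_max_right _ _)) ht
    rwa [hy.picard_eq hθ hf hMf, hy'.picard_eq hθ hf hMf] at this
  intro t ht
  refine (hg t ht).trans ?_
  rcases max_cases a (sSup (g '' J)) with ⟨h, _⟩ | ⟨h, _⟩ <;> rw [h] at key
  · refine key.trans (add_le_add_right (le_div_self hCη hκ ?_) _)
    linarith [hν.κ_nonneg]
  · have : sSup (g '' J) ≤ C * η / (1 - κ) := by
      rw [le_div_iff₀ hκ]
      linarith
    exact this.trans (le_add_of_nonneg_left (mul_nonneg hν.κ_nonneg ha))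

theorem StepContraction.exists_window (hν : StepContraction θ A Lf ν c₁ c₂ κ C)
    (hθ : StrictMono θ) (hf : RdContinuous f) (hMf : ∀ t x, ‖f t x‖ ≤ Mf)
    (hlip : ∀ t x₁ x₂, ‖f t x₁ - f t x₂‖ ≤ Lf * ‖x₁ - x₂‖) (hy : DeltaSolution A f c y)
    (hy' : DeltaSolution A f c' y') {B : ℝ} (hB : ∀ t, ‖y t - y' t‖ ≤ B) {ε : ℝ} (hε : 0 < ε) :
    ∃ M : ℕ, ∃ η > 0, ∀ (k : ℤ) (L : ℕ), M ≤ L →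
      (∀ i : ℕ, i ≤ L → ‖c (k + i) - c' (k + i)‖ ≤ η) →
      ∀ j : ℕ, M ≤ j → j ≤ L → ∀ t ∈ Icc (θ (2 * (k + j) - 1)) (θ (2 * (k + j))),
        ‖y (clampPt hθ (k + j) t) - y' (clampPt hθ (k + j) t)‖ < ε := by
  have hκ : 0 < 1 - κ := sub_pos.2 hν.κ_lt_one
  have hc₁ := hν.c₁_pos
  have hC := hν.C_nonneg
  have hB0 : 0 ≤ c₂ * B := mul_nonneg hν.c₂_nonneg ((norm_nonneg _).trans (hB (clampPt hθ 0 0)))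
  obtain ⟨M, hM⟩ : ∃ M : ℕ, κ ^ M * (c₂ * B) < c₁ * ε / 2 := by
    have h2 : Tendsto (fun n : ℕ => κ ^ n * (c₂ * B)) atTop (𝓝 (0 * (c₂ * B))) :=
      (tendsto_pow_atTop_nhds_zero_of_lt_one hν.κ_nonneg hν.κ_lt_one).mul_const _
    rw [zero_mul] at h2
    exact (h2.eventually_lt_const (by positivity)).exists
  set η := c₁ * ε * (1 - κ) ^ 2 / (2 * (C + 1)) with hη_def
  have hη : 0 < η := by positivity
  -- `K` is the fixed point of `a ↦ κ * a + C * η / (1 - κ)`, so bounds of the form `κ ^ j * (c₂ *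
  -- B) + K` reproduce themselves. `M` and `η` make each summand at most half of `c₁ * ε`.
  set K := C * η / (1 - κ) / (1 - κ) with hK_def
  have hK0 : 0 ≤ K := by positivity
  have hK : K ≤ c₁ * ε / 2 := by
    have : K = c₁ * ε / 2 * (C / (C + 1)) := by
      rw [hK_def, hη_def]; field_simp
    rw [this]
    exact mul_le_of_le_one_right (by positivity) ((div_le_one (by positivity)).2 (by linarith))
  have hK' : C * η / (1 - κ) = (1 - κ) * K := by rw [hK_def]; field_simp
  refine ⟨M, η, hη, fun k L _ hc => ?_⟩
  have main : ∀ j : ℕ, j ≤ L → ∀ t ∈ Icc (θ (2 * (k + j) - 1)) (θ (2 * (k + j))),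
      ν (k + j) t (y (clampPt hθ (k + j) t) - y' (clampPt hθ (k + j) t))
        ≤ κ ^ j * (c₂ * B) + K := by
    intro j
    induction j with
    | zero =>
      intro _ t ht
      rw [pow_zero, one_mul]
      exact ((hν.upper _ t ht _).trans (mul_le_mul_of_nonneg_left (hB _) hν.c₂_nonneg)).trans
        (le_add_of_nonneg_right hK0)
    | succ j ih =>
      intro hj t ht
      have e : k + ((j + 1 : ℕ) : ℤ) = k + j + 1 := by push_cast; ring
      have hcj := hc (j + 1) hj
      rw [e] at ht hcj ⊢
      refine (hν.solution_step hθ hf hMf hlip hy hy' hB hη.le ?_ (hc j (by lia)) hcj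
        (ih (by lia)) t ht).trans (le_of_eq ?_)
      · exact add_nonneg (mul_nonneg (pow_nonneg hν.κ_nonneg _) hB0) hK0
      · rw [hK']; ring
  intro j hMj hjL t ht
  have h1 := (hν.lower _ t ht _).trans (main j hjL t ht)
  have h2 : κ ^ j * (c₂ * B) ≤ κ ^ M * (c₂ * B) :=
    mul_le_mul_of_nonneg_right (pow_le_pow_of_le_one hν.κ_nonneg hν.κ_lt_one.le hMj) hB0
  refine lt_of_mul_lt_mul_left (a := c₁) ?_ hc₁.le
  linarith

end DeltaSolution

/-! ### Separation of solutions whose forcings differ. -/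

section Separation

variable {θ : ℤ → ℝ} {E : Type*} [NormedAddCommGroup E] [NormedSpace ℝ E]

theorem exists_Icc_norm_gt {z d : ℝ → E} {a b L e K K' : ℝ} {v : E} (hL : 0 < L)
    (hab : L ≤ b - a) (he : 0 < e) (hv : e ≤ ‖v‖) (hK : 0 ≤ K) (hK' : 0 < K')
    (hz : ContinuousOn z (Icc a b))
    (hd : ∀ t ∈ Ico a b, HasDerivWithinAt z (d t) (Icc a b) t)
    (hdv : ∀ t ∈ Ico a b, ‖d t - v‖ ≤ K * ‖z t‖) (hdK : ∀ t ∈ Ico a b, ‖d t‖ ≤ K') :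
    ∃ s u, min (L / 2) (e / (2 * (2 / L + K)) / (2 * K')) ≤ u - s ∧ Icc s u ⊆ Icc a b ∧
      ∀ t ∈ Icc s u, e / (2 * (2 / L + K)) / 2 < ‖z t‖ := by
  set m := e / (2 * (2 / L + K)) with hm_def
  have hm : 0 < m := by positivity
  have hlt : a ≤ b := by linarith
  have hright : ∀ t ∈ Ico a b, HasDerivWithinAt z (d t) (Ici t) t := fun t ht =>
    (hd t ht).mono_of_mem_nhdsWithin (Icc_mem_nhdsGE_of_mem ht)
  obtain ⟨t₀, ht₀, hmt⟩ : ∃ t ∈ Icc a b, m < ‖z t‖ := by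
    by_contra! hcon
    -- If `‖z‖ ≤ m` throughout, `z` moves like `t • v` up to `K * m * (b - a)`, yet its net change
    -- is at most `2 * m`. The choice of `m` makes the two total at most half of `(b - a) * e`, a
    -- contradiction.
    have h1 := norm_image_sub_le_of_norm_deriv_right_le_segment (f := fun t => z t - t • v)
      (f' := fun t => d t - (1 : ℝ) • v) (C := K * m) (hz.sub (by fun_prop))
      (fun t ht => (hright t ht).sub ((hasDerivWithinAt_id t _).smul_const v))
      (fun t ht => by
        rw [one_smul]
        exact (hdv t ht).trans
          (mul_le_mul_of_nonneg_left (hcon t (Ico_subset_Icc_self ht)) hK))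
      b (right_mem_Icc.2 hlt)
    have h2 : ‖(b - a) • v‖ ≤ ‖z b‖ + ‖z a‖ + ‖(z b - b • v) - (z a - a • v)‖ := by
      have : (b - a) • v = z b - z a - ((z b - b • v) - (z a - a • v)) := by module
      rw [this]
      exact (norm_sub_le _ _).trans (add_le_add_left (norm_sub_le _ _) _)
    rw [norm_smul, Real.norm_of_nonneg (by linarith)] at h2
    have h3 : (b - a) * e ≤ (b - a) * ‖v‖ := mul_le_mul_of_nonneg_left hv (by linarith)
    have h4 := hcon a (left_mem_Icc.2 hlt)
    have h5 := hcon b (right_mem_Icc.2 hlt)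
    have h6 : (b - a) * e ≤ 2 * m + K * m * (b - a) := by linarith
    have h7 : 2 * m ≤ 2 / L * m * (b - a) := by
      have : 2 * m = 2 / L * m * L := by field_simp
      rw [this]
      gcongr
    have h8 : (b - a) * e ≤ (b - a) * (m * (2 / L + K)) := by linarith
    have h9 : m * (2 / L + K) = e / 2 := by rw [hm_def]; field_simp
    rw [h9] at h8
    nlinarith [mul_pos (hL.trans_le hab) he]
  have hlip : ∀ s ∈ Icc a b, ∀ t ∈ Icc a b, s ≤ t → ‖z t - z s‖ ≤ K' * (t - s) :=
    fun s hs t ht hst => norm_image_sub_le_of_norm_deriv_right_le_segment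
      (hz.mono (Icc_subset_Icc hs.1 ht.2))
      (fun x hx => hright x ⟨hs.1.trans hx.1, hx.2.trans_le ht.2⟩)
      (fun x hx => hdK x ⟨hs.1.trans hx.1, hx.2.trans_le ht.2⟩) t (right_mem_Icc.2 hst)
  set Δ := min (L / 2) (m / (2 * K'))
  have hΔ0 : 0 ≤ Δ := by positivity
  have hΔL : Δ ≤ L / 2 := min_le_left _ _
  have hΔm : K' * Δ ≤ m / 2 := by
    calc K' * Δ ≤ K' * (m / (2 * K')) := mul_le_mul_of_nonneg_left (min_le_right _ _) hK'.le
      _ = m / 2 := by field_simp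
  have hclose : ∀ t ∈ Icc a b, |t - t₀| ≤ Δ → m / 2 < ‖z t‖ := fun t ht htΔ => by
    have h1 : ‖z t₀ - z t‖ ≤ K' * |t - t₀| := by
      rcases le_total t t₀ with h | h
      · rw [abs_sub_comm, abs_of_nonneg (sub_nonneg.2 h)]
        exact hlip t ht t₀ ht₀ h
      · rw [norm_sub_rev, abs_of_nonneg (sub_nonneg.2 h)]
        exact hlip t₀ ht₀ t ht h
    have h2 : K' * |t - t₀| ≤ K' * Δ := mul_le_mul_of_nonneg_left htΔ hK'.le
    have h3 := norm_sub_norm_le (z t₀) (z t)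
    linarith
  -- Since `Δ ≤ L / 2`, an interval of length `Δ` fits on at least one side of `t₀`.
  rcases le_total (t₀ + Δ) b with h | h
  · refine ⟨t₀, t₀ + Δ, by linarith, Icc_subset_Icc ht₀.1 h, fun t ht =>
      hclose t ⟨ht₀.1.trans ht.1, ht.2.trans h⟩ ?_⟩
    rw [abs_of_nonneg (sub_nonneg.2 ht.1)]
    linarith [ht.2]
  · have h' : a ≤ t₀ - Δ := by linarith
    refine ⟨t₀ - Δ, t₀, by linarith, Icc_subset_Icc h' ht₀.2, fun t ht =>
      hclose t ⟨h'.trans ht.1, ht.2.trans ht₀.2⟩ ?_⟩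
    rw [abs_sub_comm, abs_of_nonneg (sub_nonneg.2 ht.2)]
    linarith [ht.1]

variable {A : E →L[ℝ] E} {f : timeScale θ → E → E} {c c' : ℤ → E} {y y' : timeScale θ → E}

theorem DeltaSolution.frequentlySeparated (hy : DeltaSolution A f c y)
    (hy' : DeltaSolution A f c' y') (hθ : StrictMono θ) {L : ℝ} (hL : 0 < L)
    (hLθ : ∀ k : ℤ, L ≤ θ (2 * k) - θ (2 * k - 1)) {Lf : ℝ} (hLf : 0 ≤ Lf)
    (hlip : ∀ t x₁ x₂, ‖f t x₁ - f t x₂‖ ≤ Lf * ‖x₁ - x₂‖) {B Mc e : ℝ}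
    (hB : ∀ t, ‖y t - y' t‖ ≤ B) (hMc : ∀ k, ‖c k - c' k‖ ≤ Mc) (he : 0 < e)
    (hfreq : ∃ᶠ k : ℕ in atTop, e ≤ ‖c k - c' k‖) : FrequentlySeparated y y' := by
  obtain ⟨φ, hφ, hφe⟩ := extraction_of_frequently_atTop hfreq
  have hB0 : 0 ≤ B := (norm_nonneg _).trans (hB (clampPt hθ 0 0))
  have hMc0 : 0 ≤ Mc := (norm_nonneg _).trans (hMc 0)
  set K := ‖A‖ + Lf
  have hK : 0 ≤ K := by positivity
  -- The summand 1 only makes the derivative bound positive.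
  have hK' : 0 < K * B + Mc + 1 := by positivity
  have key : ∀ q : ℕ, _ := fun q =>
    exists_Icc_norm_gt (z := fun t => y (clampPt hθ (φ q) t) - y' (clampPt hθ (φ q) t))
      (d := fun t => (A (y (clampPt hθ (φ q) t))
          + inhomogeneity hθ f c (φ q) (fun u => y (clampPt hθ (φ q) u)) t)
        - (A (y' (clampPt hθ (φ q) t))
          + inhomogeneity hθ f c' (φ q) (fun u => y' (clampPt hθ (φ q) u)) t))
      (K := K) (K' := K * B + Mc + 1) hL (hLθ (φ q)) he (hφe q) hK hK'
      ((hy.continuous_clampPt hθ _).sub (hy'.continuous_clampPt hθ _)).continuousOn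
      (fun t ht => (hy.hasDerivWithinAt hθ ht).sub (hy'.hasDerivWithinAt hθ ht))
  have hdv : ∀ (k : ℤ) (t : ℝ), ‖(A (y (clampPt hθ k t))
        + inhomogeneity hθ f c k (fun u => y (clampPt hθ k u)) t)
      - (A (y' (clampPt hθ k t))
        + inhomogeneity hθ f c' k (fun u => y' (clampPt hθ k u)) t) - (c k - c' k)‖
      ≤ K * ‖y (clampPt hθ k t) - y' (clampPt hθ k t)‖ := fun k t => by
    have : (A (y (clampPt hθ k t))
        + inhomogeneity hθ f c k (fun u => y (clampPt hθ k u)) t)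
      - (A (y' (clampPt hθ k t))
        + inhomogeneity hθ f c' k (fun u => y' (clampPt hθ k u)) t) - (c k - c' k)
        = A (y (clampPt hθ k t) - y' (clampPt hθ k t))
          + (f (clampPt hθ k t) (y (clampPt hθ k t))
            - f (clampPt hθ k t) (y' (clampPt hθ k t))) := by
      simp only [inhomogeneity, map_sub]
      abel
    rw [this, add_mul]
    exact (norm_add_le _ _).trans (add_le_add (A.le_opNorm _) (hlip _ _ _))
  have key' := fun q => key q (fun t _ => hdv (φ q) t) (fun t _ => by
    have h1 := (hdv (φ q) t).trans (mul_le_mul_of_nonneg_left (hB _) hK)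
    have h2 := hMc (φ q)
    have h3 := norm_le_norm_add_norm_sub' ((A (y (clampPt hθ (φ q) t))
        + inhomogeneity hθ f c (φ q) (fun u => y (clampPt hθ (φ q) u)) t)
      - (A (y' (clampPt hθ (φ q) t))
        + inhomogeneity hθ f c' (φ q) (fun u => y' (clampPt hθ (φ q) u)) t))
      (c (φ q) - c' (φ q))
    linarith)
  choose a b hab hsub hgt using key'
  refine ⟨e / (2 * (2 / L + K)) / 2, _, ?_, ?_, a, b, hab,
    fun q => (hsub q).trans (Icc_subset_timeScale θ _), ?_, ?_⟩
  · positivity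
  · positivity
  · intro q r hqr
    rw [Set.disjoint_left]
    intro t ht ht'
    have := index_unique hθ (hsub q ht) (hsub r ht')
    exact hqr (hφ.injective (by exact_mod_cast this))
  · intro q t ht
    have := hgt q t ht
    rwa [clampPt_coe hθ (hsub q ht)] at this

end Separation

/-! ### Orbits of the map, commensurability of periods, and proximality. -/

section Orbits

theorem orbitSequences_natCast {α : Type*} {F : α → α} {ζ : ℤ → α} (h : ζ ∈ orbitSequences F)
    (k : ℕ) : ζ k = F^[k] (ζ 0) := by
  induction k with
  | zero => rfl
  | succ k ih => rw [Function.iterate_succ_apply', ← ih, Nat.cast_succ, h]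

theorem mem_periodicPts_of_orbit {α : Type*} {F : α → α} {ζ : ℤ → α} (h : ζ ∈ orbitSequences F)
    {q : ℕ} (hq : 0 < q) (hζ : ∀ k, ζ (k + q) = ζ k) : ζ 0 ∈ Function.periodicPts F :=
  ⟨q, hq, by
    rw [Function.IsPeriodicPt, Function.IsFixedPt, ← orbitSequences_natCast h, ← hζ 0, zero_add]⟩

theorem exists_orbit_of_isPeriodicPt {α : Type*} {F : α → α} {x : α} {r : ℕ} (hr : 0 < r)
    (hx : Function.IsPeriodicPt F r x) :
    ∃ ζ ∈ orbitSequences F, ζ 0 = x ∧ ∀ k, ζ (k + r) = ζ k := by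
  have hr' : (r : ℤ) ≠ 0 := by exact_mod_cast hr.ne'
  refine ⟨fun k => F^[(k % r).toNat] x, fun k => ?_, by simp, fun k => by simp⟩
  change F^[((k + 1) % r).toNat] x = F (F^[(k % r).toNat] x)
  rw [← Function.iterate_succ_apply' F, ← hx.iterate_mod_apply ((k % r).toNat + 1)]
  congr 2
  have h1 := Int.emod_nonneg k hr'
  have h2 := Int.emod_nonneg (k + 1) hr'
  zify
  rw [Int.toNat_of_nonneg h1, Int.toNat_of_nonneg h2, Int.emod_add_emod]

/-- The lower bound on `u` excludes the junk value of a real `limsup`. -/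
theorem exists_frequently_lt_of_limsup_pos {u : ℕ → ℝ} (hu : ∀ k, 0 ≤ u k)
    (h : 0 < limsup u atTop) : ∃ e > 0, ∃ᶠ k in atTop, e ≤ u k := by
  obtain ⟨e, he, he'⟩ := exists_between h
  exact ⟨e, he, (frequently_lt_of_lt_limsup
    (isBoundedUnder_of ⟨0, hu⟩ : IsBoundedUnder (· ≥ ·) atTop u).isCoboundedUnder_le he').mono
    fun _ h => h.le⟩

theorem exists_dist_iterate_lt {α : Type*} [PseudoMetricSpace α] [CompactSpace α] {F : α → α}
    (hF : Continuous F) (L : ℕ) {η : ℝ} (hη : 0 < η) :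
    ∃ ρ > 0, ∀ x y, dist x y < ρ → ∀ i ≤ L, dist (F^[i] x) (F^[i] y) < η := by
  have h : ∀ᶠ q : α × α in uniformity α, ∀ i ∈ Finset.range (L + 1),
      dist (F^[i] q.1) (F^[i] q.2) < η := by
    rw [eventually_all_finset]
    intro i _
    exact CompactSpace.uniformContinuous_of_continuous (hF.iterate i)
      (Metric.dist_mem_uniformity hη)
  obtain ⟨ρ, hρ, h⟩ := Metric.mem_uniformity_dist.1 h
  exact ⟨ρ, hρ, fun x y hxy i hi => h hxy i (Finset.mem_range.2 (by lia))⟩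

theorem PeriodicWith.natMul {E : Type*} {T : Set ℝ} {y : T → E} {τ : ℝ} (h : PeriodicWith y τ)
    (j : ℕ) : PeriodicWith y (j * τ) := by
  refine ⟨h.1.natMul j, ?_⟩
  induction j with
  | zero => intro t ht; exact congrArg y (Subtype.ext (by simp))
  | succ j ih =>
    intro t ht
    have h1 : (t : ℝ) + j * τ ∈ T := (h.1.natMul j _).2 t.2
    have h2 : (t : ℝ) + j * τ + τ ∈ T := (h.1 _).2 h1
    rw [← ih t h1, ← h.2 ⟨_, h1⟩ h2]
    exact congrArg y (Subtype.ext (by push_cast; ring))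

theorem exists_length_le {θ : ℤ → ℝ} (hθ : StrictMono θ) {ω : ℝ} {p : ℕ} (hp : 0 < p)
    (hshift : ∀ k, θ (k + 2 * p) = θ k + ω) :
    ∃ L > 0, ∀ k : ℤ, L ≤ θ (2 * k) - θ (2 * k - 1) := by
  have hper : Function.Periodic (fun k : ℤ => θ (2 * k) - θ (2 * k - 1)) (p : ℤ) := fun k => by
    change θ (2 * (k + p)) - θ (2 * (k + p) - 1) = θ (2 * k) - θ (2 * k - 1)
    rw [show 2 * (k + (p : ℤ)) - 1 = 2 * k - 1 + 2 * p by ring, mul_add, hshift, hshift,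
      add_sub_add_right_eq_sub]
  obtain ⟨l, -, hl⟩ := (Finset.Ico (0 : ℤ) p).exists_min_image
    (fun k : ℤ => θ (2 * k) - θ (2 * k - 1)) ⟨0, by simpa using hp⟩
  refine ⟨_, sub_pos.2 (left_lt_right hθ l), fun k => ?_⟩
  obtain ⟨j, hj, hj'⟩ := hper.exists_mem_Ico₀ (by exact_mod_cast hp) k
  exact (hl j (Finset.mem_Ico.2 hj)).trans_eq hj'.symm

theorem equationShift_natMul {θ : ℤ → ℝ} {E : Type*} {f : timeScale θ → E → E} {p : ℕ} {ω : ℝ}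
    (h : EquationShift θ f p ω) (j : ℕ) : EquationShift θ f (j * p : ℕ) (j * ω) := by
  refine ⟨fun k => ?_, h.periodic.natMul j, ?_⟩
  · induction j with
    | zero => simp
    | succ j ih =>
      rw [show k + 2 * ((j + 1) * p : ℕ) = k + 2 * (j * p : ℕ) + 2 * p by push_cast; ring,
        h.add_eq, ih]
      push_cast
      ring
  · induction j with
    | zero => intro t ht x; exact congrArg (f · x) (Subtype.ext (by simp))
    | succ j ih =>
      intro t ht x
      have h1 : (t : ℝ) + j * ω ∈ timeScale θ := (h.periodic.natMul j _).2 t.2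
      have h2 : (t : ℝ) + j * ω + ω ∈ timeScale θ := (h.periodic _).2 h1
      rw [← ih t h1, ← h.apply_eq ⟨_, h1⟩ h2]
      exact congrArg (f · x) (Subtype.ext (by push_cast; ring))

/-- A solution that has any period at all has a multiple of `ω` as a period, and its forcing
sequence is periodic. -/
theorem exists_forcing_period {θ : ℤ → ℝ} (hθ : StrictMono θ) {E : Type*} [NormedAddCommGroup E]
    [NormedSpace ℝ E] {A : E →L[ℝ] E} {f : timeScale θ → E → E} {c : ℤ → E} {y : timeScale θ → E}
    {p : ℕ} {ω : ℝ} (hp : 0 < p) (hs : EquationShift θ f p ω) (hy : DeltaSolution A f c y) {τ : ℝ}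
    (hτ : 0 < τ) (h : PeriodicWith y τ) : ∃ q : ℕ, 0 < q ∧ ∀ k, c (k + q) = c k := by
  obtain ⟨q, hq, hqτ⟩ := exists_shift_of_periodic hθ hτ h.1
  have hshift := shift_of_periodic hθ h.1 hqτ
  have h1 : ∀ j : ℕ, θ (0 + 2 * (j * q : ℕ)) = θ 0 + j * τ := fun j => by
    induction j with
    | zero => simp
    | succ j ih =>
      rw [show (0 : ℤ) + 2 * ((j + 1) * q : ℕ) = 0 + 2 * (j * q : ℕ) + 2 * q by push_cast; ring,
        hshift, ih]
      push_cast
      ring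
  -- Periods `τ` and `ω` shift the index by `q` and `p`. A shift by `p * q` intervals is both `q *
  -- ω` and `p * τ`, so the periods are commensurable.
  have h2 := (equationShift_natMul hs q).add_eq 0
  have h3 := h1 p
  rw [mul_comm p q, h2] at h3
  have h4 : (q : ℝ) * ω = p * τ := by linarith
  refine ⟨q * p, Nat.mul_pos hq hp, fun k => ?_⟩
  exact hy.forcing_add_eq hθ (equationShift_natMul hs q) (h4 ▸ h.natMul p) k

theorem StepContraction.proximalPair {θ : ℤ → ℝ} (hθ : StrictMono θ) {E : Type*}
    [NormedAddCommGroup E] [NormedSpace ℝ E] [CompleteSpace E] {A : E →L[ℝ] E}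
    {f : timeScale θ → E → E} {Mf Lf : ℝ} {ν : ℤ → ℝ → E → ℝ} {c₁ c₂ κ C : ℝ}
    (hν : StepContraction θ A Lf ν c₁ c₂ κ C) (hf : RdContinuous f) (hMf : ∀ t x, ‖f t x‖ ≤ Mf)
    (hlip : ∀ t x₁ x₂, ‖f t x₁ - f t x₂‖ ≤ Lf * ‖x₁ - x₂‖) {Λ : Set E} (hΛ : IsCompact Λ)
    {F : Λ → Λ} (hF : Continuous F) {ζ ζ' : ℤ → Λ} (hζ : ζ ∈ orbitSequences F)
    (hζ' : ζ' ∈ orbitSequences F) {y y' : timeScale θ → E}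
    (hy : DeltaSolution A f (fun k => ζ k) y) (hy' : DeltaSolution A f (fun k => ζ' k) y') {B : ℝ}
    (hB : ∀ t, ‖y t - y' t‖ ≤ B)
    (hprox : liminf (fun k : ℕ => dist (F^[k] (ζ 0)) (F^[k] (ζ' 0))) atTop = 0) :
    ProximalPair y y' := by
  have : CompactSpace Λ := isCompact_iff_compactSpace.1 hΛ
  intro ε hε N
  obtain ⟨M, η, hη, hwin⟩ := hν.exists_window hθ hf hMf hlip hy hy' hB hε
  obtain ⟨ρ, hρ, hclose⟩ := exists_dist_iterate_lt hF (M + N) hη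
  obtain ⟨D, hD⟩ : ∃ D, ∀ x x' : Λ, dist x x' ≤ D :=
    ⟨_, fun x x' => Metric.dist_le_diam_of_mem isCompact_univ.isBounded (mem_univ x) (mem_univ x')⟩
  obtain ⟨k, hk⟩ := (frequently_lt_of_liminf_lt
    (isBoundedUnder_of ⟨D, fun k => hD _ _⟩ : IsBoundedUnder (· ≤ ·) atTop
      (fun k : ℕ => dist (F^[k] (ζ 0)) (F^[k] (ζ' 0)))).isCoboundedUnder_ge
    (hprox.trans_lt hρ)).exists
  have hwin' := hwin k (M + N) (by lia) (fun i hi => by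
    have := hclose _ _ hk i hi
    rw [← Function.iterate_add_apply, ← Function.iterate_add_apply,
      ← orbitSequences_natCast hζ, ← orbitSequences_natCast hζ', Subtype.dist_eq, dist_eq_norm,
      add_comm i k, Nat.cast_add] at this
    exact this.le)
  -- The first `M` intervals after the near meeting of the orbits are the transient; the following
  -- ones are the required stretch.
  refine ⟨k + M, fun t ht => ?_⟩
  obtain ⟨l, hl⟩ := mem_timeScale.1 t.2
  have h1 := index_le_of_le hθ (left_mem_Icc.2 (left_lt_right hθ (k + M)).le) hl ht.1
  have h2 := index_le_of_le hθ hl (right_mem_Icc.2 (left_lt_right hθ (k + M + N)).le) ht.2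
  obtain ⟨j, rfl⟩ : ∃ j : ℕ, l = k + j := ⟨(l - k).toNat, by lia⟩
  have := hwin' j (by lia) (by lia) t hl
  rwa [clampPt_coe hθ hl] at this

end Orbits

end

/-! ### Transfer of chaos from the map to the equation. -/

theorem mainTheorem1 {n : ℕ}
    -- the time scale
    (θ : ℤ → ℝ) (hθ : StrictMono θ) (hθ_top : Tendsto θ atTop atTop)
    (hθ_bot : Tendsto θ atBot atBot) (hθ_neg : θ (-1) < 0) (hθ_pos : 0 < θ 0)
    (ω : ℝ) (hω : 0 < ω) (hωT : TimeScalePeriodic (timeScale θ) ω)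
    -- `p` is the number of gaps in one period of the time scale
    (p : ℕ) (hp : θ (2 * (p : ℤ)) = θ 0 + ω)
    -- the equation and the map
    (A : Matrix (Fin n) (Fin n) ℝ)
    (f : timeScale θ → EuclideanSpace ℝ (Fin n) → EuclideanSpace ℝ (Fin n))
    (hf : RdContinuous f)
    (Λ : Set (EuclideanSpace ℝ (Fin n))) (hΛ : IsCompact Λ) (F : Λ → Λ) (hF : Continuous F)
    -- (C1)
    (C1 : ∀ k : ℤ, (1 + gapLength θ k • A).det ≠ 0)
    -- (C2)
    (C2 : ∀ μ ∈ spectrum ℂ ((monodromyMatrix θ A ω p).map (algebraMap ℝ ℂ)), ‖μ‖ < 1)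
    -- (C3)
    (C3 : (∃ Mf : ℝ, 0 < Mf ∧ ∀ t y, ‖f t y‖ ≤ Mf) ∧
      ∃ MF : ℝ, 0 < MF ∧ ∀ η : Λ, ‖(F η : EuclideanSpace ℝ (Fin n))‖ ≤ MF)
    -- (C4)
    (Lf : ℝ) (hLf : 0 < Lf) (C4 : ∀ t y₁ y₂, ‖f t y₁ - f t y₂‖ ≤ Lf * ‖y₁ - y₂‖)
    -- the constants `N` and `lam` of the exponential bound of the transition matrix
    (N lam : ℝ) (hN : 0 < N) (hlam : 0 < lam)
    (hX : ∀ s r : ℝ, r ≤ s →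
      matNorm (transitionMatrix θ A s r) ≤ N * Real.exp (-lam * (s - r)))
    -- (C5)
    (C5 : N * Lf * (1 / lam + p * maxGap θ p / (1 - Real.exp (-lam * psi θ ω))) < 1)
    -- (C6)
    (C6 : -lam + N * Lf + p / psi θ ω * Real.log (1 + N * Lf * maxGap θ p) < 0)
    -- (C7)
    (C7 : ∀ (t : timeScale θ) (h : (t : ℝ) + ω ∈ timeScale θ) (y : EuclideanSpace ℝ (Fin n)),
      f ⟨t + ω, h⟩ y = f t y)
    -- the map is Li-Yorke chaotic, and the points of the scrambled set generate two-sided sequences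
    (S : Set Λ) (hS : LiYorkeChaoticMap F S) (hSΘ : ∀ x ∈ S, ∃ ζ ∈ orbitSequences F, ζ 0 = x) :
    LiYorkeChaoticEquation θ ω A f F := by
  have hp0 : 0 < p := by
    rcases Nat.eq_zero_or_pos p with rfl | h
    · simp at hp
      exact absurd hp hω.ne'
    · exact h
  have hshift : ∀ k, θ (k + 2 * (p : ℤ)) = θ k + ω := shift_of_periodic hθ hωT hp
  have hs : EquationShift θ f p ω := ⟨hshift, hωT, C7⟩
  set B := Matrix.toEuclideanCLM (n := Fin n) (𝕜 := ℝ) A with hB_def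
  have hdecay : ImpulsiveDecay θ B N lam := fun k l hkl t ht u hu htu =>
    norm_flow_mul_jumpProd_le hθ hθ_neg hθ_pos A hX hkl ht hu htu
  obtain ⟨ν, c₁, c₂, κ, C, hν⟩ := hdecay.exists_stepContraction hN hθ hθ_neg hθ_pos hω hp0 hshift
    hLf C6
  obtain ⟨⟨Mf, -, hMf⟩, -⟩ := C3
  obtain ⟨L, hL, hLθ⟩ := exists_length_le hθ hp0 hshift
  obtain ⟨Mc, hMc⟩ : ∃ Mc, ∀ x : Λ, ‖(x : EuclideanSpace ℝ (Fin n))‖ ≤ Mc := by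
    obtain ⟨Mc, h⟩ := hΛ.isBounded.exists_norm_le
    exact ⟨Mc, fun x => h x x.2⟩
  have hsol : ∀ ζ : ℤ → Λ, ∃ y, DeltaSolution B f (fun k => ζ k) y ∧ ∃ M, ∀ t, ‖y t‖ ≤ M :=
    fun ζ => hν.exists_deltaSolution hθ hf hMf hLf.le C4 fun k => hMc (ζ k)
  have hmem : ∀ {ζ : ℤ → Λ} {y}, ζ ∈ orbitSequences F → DeltaSolution B f (fun k => ζ k) y →
      (∃ M, ∀ t, ‖y t‖ ≤ M) → y ∈ boundedSolutions θ A f F := fun {ζ y} hζ hy hM => by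
    obtain ⟨M, hM⟩ := hM
    refine ⟨isBounded_iff_forall_norm_le.2 ⟨M, ?_⟩, ζ, hζ, hy⟩
    rintro _ ⟨t, rfl⟩
    exact hM t
  have hbdd : ∀ {y y' : timeScale θ → EuclideanSpace ℝ (Fin n)}, (∃ M, ∀ t, ‖y t‖ ≤ M) →
      (∃ M, ∀ t, ‖y' t‖ ≤ M) → ∃ M, ∀ t, ‖y t - y' t‖ ≤ M := by
    rintro y y' ⟨M, hM⟩ ⟨M', hM'⟩
    exact ⟨M + M', fun t => (norm_sub_le _ _).trans (add_le_add (hM t) (hM' t))⟩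
  have hsep : ∀ {ζ ζ' : ℤ → Λ} {y y'}, ζ ∈ orbitSequences F → ζ' ∈ orbitSequences F →
      DeltaSolution B f (fun k => ζ k) y → DeltaSolution B f (fun k => ζ' k) y' →
      (∃ M, ∀ t, ‖y t‖ ≤ M) → (∃ M, ∀ t, ‖y' t‖ ≤ M) →
      0 < limsup (fun k : ℕ => dist (F^[k] (ζ 0)) (F^[k] (ζ' 0))) atTop →
      FrequentlySeparated y y' := fun {ζ ζ' y y'} hζ hζ' hy hy' hM hM' hlim => by
    obtain ⟨M, hM⟩ := hbdd hM hM'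
    obtain ⟨e, he, hfreq⟩ := exists_frequently_lt_of_limsup_pos (fun _ => dist_nonneg) hlim
    refine hy.frequentlySeparated hy' hθ hL hLθ hLf.le C4 hM (Mc := Mc + Mc)
      (fun k => (norm_sub_le _ _).trans (add_le_add (hMc _) (hMc _))) he (hfreq.mono fun k hk => ?_)
    rwa [← orbitSequences_natCast hζ, ← orbitSequences_natCast hζ', Subtype.dist_eq,
      dist_eq_norm] at hk
  choose Y hY hYb using hsol
  choose o ho ho0 using hSΘ
  have hper : ∀ {ζ : ℤ → Λ} {y}, ζ ∈ orbitSequences F → DeltaSolution B f (fun k => ζ k) y →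
      (∃ τ : ℝ, 0 < τ ∧ PeriodicWith y τ) → ζ 0 ∈ Function.periodicPts F := by
    rintro ζ y hζ hy ⟨τ, hτ, h⟩
    obtain ⟨q, hq, hq'⟩ := exists_forcing_period hθ hp0 hs hy hτ h
    exact mem_periodicPts_of_orbit hζ hq fun k => Subtype.ext (hq' k)
  refine ⟨fun m hm => ?_, range fun x : S => Y (o x x.2), ?_, ?_, ?_, ?_, ?_⟩
  -- Translation by `ω` advances the orbit by `p` steps. A `jω`-period of the solution would make `j
  -- * p` a period of `x`, hence a multiple of `m * p`.
  · obtain ⟨x, hx, hxm⟩ := hS.periodic (m * p) (Nat.mul_pos hm hp0)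
    obtain ⟨ζ, hζ, hζ0, hζp⟩ := exists_orbit_of_isPeriodicPt (Nat.mul_pos hm hp0) hx
    refine ⟨Y ζ, hmem hζ (hY ζ) (hYb ζ), ?_, fun j hj hjm h => ?_⟩
    · obtain ⟨M, hM⟩ := hYb ζ
      exact hν.eq_of_deltaSolution_shift hθ hf hMf C4 (equationShift_natMul hs m)
        (fun k => congrArg Subtype.val (hζp k)) (hY ζ) hM
    · have h1 := Subtype.ext ((hY ζ).forcing_add_eq hθ (equationShift_natMul hs j) h 0)
      rw [zero_add, orbitSequences_natCast hζ, hζ0] at h1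
      have h2 : m * p ∣ j * p := hxm ▸ Function.IsPeriodicPt.minimalPeriod_dvd h1
      exact hjm.not_ge (Nat.le_of_dvd hj (Nat.dvd_of_mul_dvd_mul_right hp0 h2))
  · rintro _ ⟨x, rfl⟩
    exact hmem (ho x x.2) (hY _) (hYb _)
  · intro hcount
    -- The solution reveals its forcing at index 0, which is the point of the scrambled set itself.
    have hinj : Function.Injective fun x : S => Y (o x x.2) := fun x x' h => by
      have h1 := (hY (o x x.2)).forcing_eq hθ 0
      have h2 := (hY (o x' x'.2)).forcing_eq hθ 0
      simp only at h
      rw [h] at h1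
      have h3 : o x x.2 0 = o x' x'.2 0 := Subtype.ext (h1.trans h2.symm)
      rw [ho0, ho0] at h3
      exact Subtype.ext h3
    have : Countable (range fun x : S => Y (o x x.2)) := hcount.to_subtype
    have : Countable S :=
      ((Set.rangeFactorization_injective (f := fun x : S => Y (o x x.2))).2 hinj).countable
    exact hS.uncountable (Set.countable_coe_iff.1 this)
  · rintro _ ⟨x, rfl⟩ h
    have := hper (ho x x.2) (hY _) h
    rw [ho0] at this
    exact hS.no_periodic x x.2 this
  · rintro _ ⟨x, rfl⟩ _ ⟨x', rfl⟩ hne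
    have hxx : (x : Λ) ≠ x' := fun h => hne (by rw [Subtype.ext h])
    obtain ⟨M, hM⟩ := hbdd (hYb (o x x.2)) (hYb (o x' x'.2))
    refine ⟨hν.proximalPair hθ hf hMf C4 hΛ hF (ho x x.2) (ho x' x'.2) (hY _) (hY _) hM ?_,
      hsep (ho x x.2) (ho x' x'.2) (hY _) (hY _) (hYb _) (hYb _) ?_⟩
    · rw [ho0, ho0]
      exact hS.proximal x x.2 x' x'.2 hxx
    · rw [ho0, ho0]
      exact hS.separated x x.2 x' x'.2 hxx
  · rintro _ ⟨x, rfl⟩ z ⟨hzb, ζ, hζ, hz⟩ hzp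
    obtain ⟨M, hM⟩ := isBounded_iff_forall_norm_le.1 hzb
    refine hsep (ho x x.2) hζ (hY _) hz (hYb _) ⟨M, fun t => hM _ (mem_range_self t)⟩ ?_
    rw [ho0]
    exact hS.separated_periodic x x.2 _ (hper hζ hz hzp)
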